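/- Let $c(j)$ be the coefficients of $J(q)=\sum_{j\ge -1}c(j)q^j=q^{-1}+196884q+\cdots$, the elliptic modular function normalized so that $c(0)=0$. Let $I=\{(j,k): j\in\{-1,1,2,3,\dots\},\ 1\le k\le c(j)\}$. Let $\mathfrak g(A)$ be the complex Lie algebra with generators $e_{jk},f_{jk},h_{jk}$ $((j,k)\in I)$ and relations $[h_{jk},h_{pq}]=0$, $[h_{jk},e_{pq}]=-(j+p)e_{pq}$, $[h_{jk},f_{pq}]=(j+p)f_{pq}$, $[e_{jk},f_{pq}]=\delta_{jp}\delta_{kq}h_{jk}$, and $(\operatorname{ad}e_{-1,1})^j e_{jk}=(\operatorname{ad}f_{-1,1})^j f_{jk}=0$ for $j\ge 1$. The Monster Lie algebra $\mathfrak m$ is the quotient of $\mathfrak g(A)$ by its center. In $\mathfrak m$ put $h_1=\tfrac12(h_{-1,1}-h_{1,1})$, $h_2=-\tfrac12(h_{-1,1}+h_{1,1})$ and, for $(a,b)\in\mathbb Z^2$, $\mathfrak m_{(a,b)}=\{x\in\mathfrak m: [h_1,x]=ax,\ [h_2,x]=bx\}$. Then $\mathfrak m=\bigoplus_{k\in\mathbb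 Z}\mathfrak m_k$ is $\mathbb Z$-graded, where $\mathfrak m_k=\bigoplus_{a+b=k}\mathfrak m_{(a,b)}$ for $k\ne 0$ and $\mathfrak m_0$ is the subalgebra generated by $e_{-1,1},f_{-1,1},h_1,h_2$. Let $$\widehat{\mathfrak m}=\Big\{(x_k)_{k\in\mathbb Z}\in\prod_{k}\mathfrak m_k : x_k=0\text{ for all sufficiently negative }k\Big\}$$ with the bracket $[x,y]_k=\sum_i[x_i,y_{k-i}]$ and the topology induced from the product topology (each finite-dimensional $\mathfrak m_k$ having its usual topology). Let $\operatorname{Aut}(\widehat{\mathfrak m})$ be the group of Lie algebra automorphisms of $\widehat{\mathfrak m}$ with the topology of pointwise convergence. For $n\ge 1$ let $$\widehat U^+_n=\Big\{\varphi\in\operatorname{Aut}(\widehat{\mathfrak m}) : \varphi(y)\in y+\prod_{j\ge k+n}\mathfrak m_j\ \text{ for all } k\in\mathbb Z,\ y\in\mathfrak m_k\Big\}.$$ For $x\in\mathfrak m_\ell$, $\ell\ge1$, let $\exp(\operatorname{ad}x)\in\operatorname{Aut}(\widehat{\mathfrak m})$ be given by $(\exp(\operatorname{ad}x)(y))_k=\sum_{m\ge0}\frac1{m!}\big((\operatorname{ad}x)^m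 y\big)_k$ (a finite sum for each $k$). For $x_\ell\in\mathfrak m_\ell$ $(\ell\ge n)$ put $$\prod_{\ell=n}^\infty\exp(\operatorname{ad}x_\ell)=\lim_{N\to\infty}\exp(\operatorname{ad}x_N)\cdots\exp(\operatorname{ad}x_{n+1})\exp(\operatorname{ad}x_n),$$ the limit being taken in $\operatorname{Aut}(\widehat{\mathfrak m})$. Then for every $n\ge1$: 1. the limit $\prod_{\ell=n}^\infty\exp(\operatorname{ad}x_\ell)$ exists in $\operatorname{Aut}(\widehat{\mathfrak m})$ and is unique for every choice of $x_\ell\in\mathfrak m_\ell$ $(\ell\ge n)$; 2. $\widehat U^+_n$ is a subgroup of $\operatorname{Aut}(\widehat{\mathfrak m})$; 3. $\widehat U^+_n=\Big\{\prod_{\ell=n}^\infty\exp(\operatorname{ad}x_\ell) : x_\ell\in\mathfrak m_\ell\text{ for all }\ell\ge n\Big\}$; 4. $\widehat U^+_n$ is the closure in $\operatorname{Aut}(\widehat{\mathfrak m})$ of the subgroup generated by all $\exp(\operatorname{ad}x)$ with $x\in\mathfrak m_k$, $k\ge n$. -/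

import Mathlib

noncomputable section

namespace GradedLie

/-- The group of automorphisms of a Lie algebra; multiplication is composition. -/
instance autGroup {M : Type*} [LieRing M] [LieAlgebra ℂ M] : Group (M ≃ₗ⁅ℂ⁆ M) where
  mul f g := g.trans f
  inv f := f.symm
  mul_assoc _ _ _ := rfl
  one_mul _ := rfl
  mul_one _ := rfl
  inv_mul_cancel f := LieEquiv.ext fun x => f.symm_apply_apply x

variable {L : Type*} [LieRing L] [LieAlgebra ℂ L] (𝒢 : ℤ → Submodule ℂ L)

/-- The positive formal completion: families `(x_k)`, `x_k ∈ 𝒢 k`, vanishing for `k ≪ 0`. -/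
def completion : Submodule ℂ (∀ k : ℤ, 𝒢 k) where
  carrier := {x | ∃ N : ℤ, ∀ k < N, x k = 0}
  zero_mem' := ⟨0, fun _ _ => rfl⟩
  add_mem' := by
    rintro x y ⟨N, hN⟩ ⟨M, hM⟩
    refine ⟨min N M, fun k hk => ?_⟩
    simp [hN k (lt_of_lt_of_le hk (min_le_left _ _)), hM k (lt_of_lt_of_le hk (min_le_right _ _))]
  smul_mem' := by
    rintro c x ⟨N, hN⟩
    exact ⟨N, fun k hk => by simp [hN k hk]⟩

/-- The subspace `∏_{j ≥ k} 𝒢 j` of the completion. -/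
def tail (k : ℤ) : Submodule ℂ (completion 𝒢) where
  carrier := {x | ∀ j < k, x.1 j = 0}
  zero_mem' := fun _ _ => rfl
  add_mem' := fun {x y} hx hy j hj => by
    change x.1 j + y.1 j = 0
    rw [hx j hj, hy j hj, add_zero]
  smul_mem' := fun c x hx j hj => by
    change c • x.1 j = 0
    rw [hx j hj, smul_zero]

/-- The inclusion of the homogeneous component `𝒢 k` into the completion. -/
def incl (k : ℤ) : 𝒢 k →ₗ[ℂ] completion 𝒢 where
  toFun y := ⟨Pi.single k y, k, fun _ hj => Pi.single_eq_of_ne hj.ne _⟩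
  map_add' x y := Subtype.ext (Pi.single_add (f := fun k => 𝒢 k) k x y)
  map_smul' c x := Subtype.ext (Pi.single_smul (f := fun k => 𝒢 k) k c x)

variable {𝒢}

theorem completion_ext {x y : completion 𝒢} (h : ∀ k, (x.1 k : L) = y.1 k) : x = y :=
  Subtype.ext (funext fun k => Subtype.ext (h k))

theorem tail_mono {i j : ℤ} (h : i ≤ j) : tail 𝒢 j ≤ tail 𝒢 i :=
  fun _ hx k hk => hx k (lt_of_lt_of_le hk h)

theorem finite_terms (x y : completion 𝒢) (k : ℤ) :
    (Function.support fun i : ℤ => ⁅(x.1 i : L), (y.1 (k - i) : L)⁆).Finite := by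
  obtain ⟨N, hN⟩ := x.2
  obtain ⟨M, hM⟩ := y.2
  refine (Set.finite_Icc N (k - M)).subset fun i hi => ?_
  rw [Function.mem_support] at hi
  constructor
  · by_contra h
    exact hi (by simp [hN i (by omega)])
  · by_contra h
    exact hi (by simp [hM (k - i) (by omega)])

theorem exists_mem_tail (y : completion 𝒢) : ∃ N, y ∈ tail 𝒢 N := y.2

theorem eq_of_sub_mem_tail {y z : completion 𝒢} (N : ℤ)
    (h : ∀ M : ℕ, 1 ≤ M → y - z ∈ tail 𝒢 (N + M)) : y = z := by
  rw [← sub_eq_zero]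
  refine Subtype.ext (funext fun k => ?_)
  refine h ((k - N).toNat + 1) (by omega) k ?_
  push_cast
  omega

variable [SetLike.GradedBracket 𝒢]

/-- The bracket of the completion: `[x, y]_k = ∑_i [x_i, y_{k-i}]` (a finite sum). -/
instance : Bracket (completion 𝒢) (completion 𝒢) where
  bracket x y := ⟨fun k => ⟨∑ᶠ i : ℤ, ⁅(x.1 i : L), (y.1 (k - i) : L)⁆, by
      refine finsum_induction (fun z => z ∈ 𝒢 k) (zero_mem _) (fun _ _ => add_mem) fun i => ?_
      have := SetLike.GradedBracket.bracket_mem (x.1 i).2 (y.1 (k - i)).2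
      rwa [add_sub_cancel] at this⟩, by
    obtain ⟨N, hN⟩ := x.2
    obtain ⟨M, hM⟩ := y.2
    refine ⟨N + M, fun k hk => Subtype.ext ?_⟩
    refine finsum_eq_zero_of_forall_eq_zero fun i => ?_
    by_cases h : i < N
    · simp [hN i h]
    · simp [hM (k - i) (by omega)]⟩

theorem lie_coe (x y : completion 𝒢) (k : ℤ) :
    ((⁅x, y⁆.1 k : 𝒢 k) : L) = ∑ᶠ i : ℤ, ⁅(x.1 i : L), (y.1 (k - i) : L)⁆ := rfl

theorem lie_coe_eq_sum (x y : completion 𝒢) (k : ℤ) (s : Finset ℤ)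
    (h : ∀ i, i ∉ s → ⁅(x.1 i : L), (y.1 (k - i) : L)⁆ = 0) :
    ((⁅x, y⁆.1 k : 𝒢 k) : L) = ∑ i ∈ s, ⁅(x.1 i : L), (y.1 (k - i) : L)⁆ := by
  rw [lie_coe]
  refine finsum_eq_sum_of_support_subset _ fun i hi => ?_
  by_contra hs
  exact hi (h i hs)

theorem jacobi (x y z : completion 𝒢) : ⁅x, ⁅y, z⁆⁆ = ⁅⁅x, y⁆, z⁆ + ⁅y, ⁅x, z⁆⁆ := by
  obtain ⟨N, hx, hy, hz⟩ : ∃ N : ℤ, (∀ k < N, x.1 k = 0) ∧ (∀ k < N, y.1 k = 0) ∧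
      ∀ k < N, z.1 k = 0 := by
    obtain ⟨N, hN⟩ := x.2
    obtain ⟨M, hM⟩ := y.2
    obtain ⟨K, hK⟩ := z.2
    exact ⟨min N (min M K), fun k hk => hN k (by omega), fun k hk => hM k (by omega),
      fun k hk => hK k (by omega)⟩
  refine completion_ext fun k => ?_
  have inner : ∀ (u v w : completion 𝒢), (∀ k < N, u.1 k = 0) → (∀ k < N, v.1 k = 0) →
      (∀ k < N, w.1 k = 0) → ((⁅u, ⁅v, w⁆⁆.1 k : 𝒢 k) : L) =
        ∑ i ∈ Finset.Icc N (k - 2 * N), ∑ j ∈ Finset.Icc N (k - 2 * N),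
          ⁅(u.1 i : L), ⁅(v.1 j : L), (w.1 (k - i - j) : L)⁆⁆ := by
    intro u v w hu hv hw
    rw [lie_coe_eq_sum u ⁅v, w⁆ k (Finset.Icc N (k - 2 * N))]
    · refine Finset.sum_congr rfl fun i hi => ?_
      rw [Finset.mem_Icc] at hi
      rw [lie_coe_eq_sum v w (k - i) (Finset.Icc N (k - 2 * N)), lie_sum]
      intro j hj
      rw [Finset.mem_Icc] at hj
      by_cases h : j < N
      · simp [hv j h]
      · simp [hw (k - i - j) (by omega)]
    · intro i hi
      rw [Finset.mem_Icc] at hi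
      by_cases h : i < N
      · simp [hu i h]
      · rw [lie_coe_eq_sum v w (k - i) ∅]
        · simp
        · intro j _
          by_cases h : j < N
          · simp [hv j h]
          · simp [hw (k - i - j) (by omega)]
  have left : ((⁅⁅x, y⁆, z⁆.1 k : 𝒢 k) : L) =
        ∑ i ∈ Finset.Icc N (k - 2 * N), ∑ j ∈ Finset.Icc N (k - 2 * N),
          ⁅⁅(x.1 i : L), (y.1 j : L)⁆, (z.1 (k - i - j) : L)⁆ := by
    rw [lie_coe_eq_sum ⁅x, y⁆ z k (Finset.Icc (2 * N) (k - N))]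
    · have : ∀ l ∈ Finset.Icc (2 * N) (k - N), ⁅((⁅x, y⁆.1 l : 𝒢 l) : L), (z.1 (k - l) : L)⁆ =
          ∑ i ∈ Finset.Icc N (k - 2 * N), ⁅⁅(x.1 i : L), (y.1 (l - i) : L)⁆, (z.1 (k - l) : L)⁆ := by
        intro l hl
        rw [Finset.mem_Icc] at hl
        rw [lie_coe_eq_sum x y l (Finset.Icc N (k - 2 * N)), sum_lie]
        intro i hi
        rw [Finset.mem_Icc] at hi
        by_cases h : i < N
        · simp [hx i h]
        · simp [hy (l - i) (by omega)]
      rw [Finset.sum_congr rfl this, Finset.sum_comm]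
      refine Finset.sum_congr rfl fun i hi => ?_
      rw [Finset.mem_Icc] at hi
      rw [← finsum_eq_sum_of_support_subset (s := Finset.Icc (2 * N) (k - N)),
        ← finsum_eq_sum_of_support_subset (s := Finset.Icc N (k - 2 * N))]
      · refine (finsum_comp_equiv (Equiv.addLeft i)).symm.trans (finsum_congr fun j => ?_)
        rw [Equiv.coe_addLeft, add_sub_cancel_left i j, ← sub_sub k i j]
      · intro j hj
        rw [Function.mem_support] at hj
        rw [Finset.coe_Icc, Set.mem_Icc]
        by_contra h
        apply hj
        by_cases h' : j < N
        · simp [hy j h']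
        · simp [hz (k - i - j) (by omega)]
      · intro l hl
        rw [Function.mem_support] at hl
        rw [Finset.coe_Icc, Set.mem_Icc]
        by_contra h
        apply hl
        by_cases h' : l - i < N
        · simp [hy _ h']
        · simp [hz (k - l) (by omega)]
    · intro l hl
      rw [Finset.mem_Icc] at hl
      by_cases h : k - l < N
      · simp [hz _ h]
      · rw [lie_coe_eq_sum x y l ∅]
        · simp
        · intro j _
          by_cases h : j < N
          · simp [hx j h]
          · simp [hy (l - j) (by omega)]
  have hadd : (((⁅⁅x, y⁆, z⁆ + ⁅y, ⁅x, z⁆⁆).1 k : 𝒢 k) : L) =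
      ((⁅⁅x, y⁆, z⁆.1 k : 𝒢 k) : L) + ((⁅y, ⁅x, z⁆⁆.1 k : 𝒢 k) : L) := rfl
  rw [hadd, inner x y z hx hy hz, left, inner y x z hy hx hz,
    Finset.sum_comm (f := fun i j => ⁅(y.1 i : L), ⁅(x.1 j : L), (z.1 (k - i - j) : L)⁆⁆),
    ← Finset.sum_add_distrib]
  refine Finset.sum_congr rfl fun i _ => ?_
  rw [← Finset.sum_add_distrib]
  refine Finset.sum_congr rfl fun j _ => ?_
  rw [leibniz_lie, sub_right_comm k i j]

instance : LieRing (completion 𝒢) where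
  add_lie x y z := completion_ext fun k => by
    change ∑ᶠ i : ℤ, ⁅((x.1 i : L) + (y.1 i : L)), (z.1 (k - i) : L)⁆ =
      (∑ᶠ i : ℤ, ⁅(x.1 i : L), (z.1 (k - i) : L)⁆) + ∑ᶠ i : ℤ, ⁅(y.1 i : L), (z.1 (k - i) : L)⁆
    simp only [add_lie]
    exact finsum_add_distrib (finite_terms x z k) (finite_terms y z k)
  lie_add x y z := completion_ext fun k => by
    change ∑ᶠ i : ℤ, ⁅(x.1 i : L), ((y.1 (k - i) : L) + (z.1 (k - i) : L))⁆ =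
      (∑ᶠ i : ℤ, ⁅(x.1 i : L), (y.1 (k - i) : L)⁆) + ∑ᶠ i : ℤ, ⁅(x.1 i : L), (z.1 (k - i) : L)⁆
    simp only [lie_add]
    exact finsum_add_distrib (finite_terms x y k) (finite_terms x z k)
  lie_self x := completion_ext fun k => by
    rw [lie_coe]
    have h : ∑ᶠ i : ℤ, ⁅(x.1 i : L), (x.1 (k - i) : L)⁆ =
        - ∑ᶠ i : ℤ, ⁅(x.1 i : L), (x.1 (k - i) : L)⁆ := by
      conv_lhs => rw [← finsum_comp_equiv (Equiv.subLeft k)]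
      rw [← finsum_neg_distrib]
      refine finsum_congr fun i => ?_
      rw [Equiv.subLeft_apply, sub_sub_cancel k i, lie_skew]
    have h2 : (2 : ℂ) • ∑ᶠ i : ℤ, ⁅(x.1 i : L), (x.1 (k - i) : L)⁆ = 0 := by
      rw [two_smul]
      nth_rewrite 2 [h]
      exact add_neg_cancel _
    exact (smul_eq_zero.mp h2).resolve_left two_ne_zero
  leibniz_lie x y z := jacobi x y z

instance : LieAlgebra ℂ (completion 𝒢) where
  lie_smul c x y := completion_ext fun k => by
    change ∑ᶠ i : ℤ, ⁅(x.1 i : L), c • (y.1 (k - i) : L)⁆ =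
      c • ∑ᶠ i : ℤ, ⁅(x.1 i : L), (y.1 (k - i) : L)⁆
    simp only [lie_smul]
    exact (smul_finsum c _).symm


theorem lie_mem_tail {i j : ℤ} {x y : completion 𝒢} (hx : x ∈ tail 𝒢 i) (hy : y ∈ tail 𝒢 j) :
    ⁅x, y⁆ ∈ tail 𝒢 (i + j) := fun k hk => Subtype.ext (by
  refine finsum_eq_zero_of_forall_eq_zero fun l => ?_
  by_cases h : l < i
  · simp [hx l h]
  · simp [hy (k - l) (by omega)])

theorem ad_pow_mem_tail {x : completion 𝒢} (hx : x ∈ tail 𝒢 1) {N : ℤ} {y : completion 𝒢}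
    (hy : y ∈ tail 𝒢 N) (m : ℕ) :
    ((LieAlgebra.ad ℂ (completion 𝒢) x) ^ m) y ∈ tail 𝒢 (N + m) := by
  induction m with
  | zero => simpa using hy
  | succ m ih =>
    rw [pow_succ', Module.End.mul_apply, LieAlgebra.ad_apply]
    have := lie_mem_tail hx ih
    rwa [show (1 : ℤ) + (N + m) = N + (m + 1 : ℕ) by push_cast; ring] at this

/-- The `m`-th term `(1 / m!) (ad x)^m` of the exponential series of `ad x`. -/
def expTerm (x : completion 𝒢) (m : ℕ) : Module.End ℂ (completion 𝒢) :=
  ((m.factorial : ℂ)⁻¹) • (LieAlgebra.ad ℂ (completion 𝒢) x) ^ m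

theorem expTerm_mem_tail {x : completion 𝒢} (hx : x ∈ tail 𝒢 1) {N : ℤ} {y : completion 𝒢}
    (hy : y ∈ tail 𝒢 N) (m : ℕ) : expTerm x m y ∈ tail 𝒢 (N + m) :=
  Submodule.smul_mem _ _ (ad_pow_mem_tail hx hy m)

/-- The series `∑ (1 / m!) (ad x)^m` is pro-summable when `x` lies in `∏_{j ≥ 1} 𝒢 j`. -/
theorem expTerm_finite {x : completion 𝒢} (hx : x ∈ tail 𝒢 1) (y : completion 𝒢) (k : ℤ) :
    {m : ℕ | (expTerm x m y).1 k ≠ 0}.Finite := by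
  obtain ⟨N, hN⟩ := exists_mem_tail y
  refine (Set.finite_Iio (k - N + 1).toNat).subset fun m hm => ?_
  by_contra h
  rw [Set.mem_Iio] at h
  exact hm (expTerm_mem_tail hx hN m k (by omega))

/-- The operator `exp (ad x)`, the componentwise finite sum of its exponential series. -/
def expAdEnd (x : tail 𝒢 1) : Module.End ℂ (completion 𝒢) where
  toFun y := ⟨fun k => ∑ᶠ m : ℕ, (expTerm x.1 m y).1 k, by
    obtain ⟨N, hN⟩ := exists_mem_tail y
    refine ⟨N, fun k hk => finsum_eq_zero_of_forall_eq_zero fun m => ?_⟩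
    exact expTerm_mem_tail x.2 hN m k (by omega)⟩
  map_add' y z := Subtype.ext (funext fun k => by
    change ∑ᶠ m : ℕ, (expTerm x.1 m (y + z)).1 k =
      (∑ᶠ m : ℕ, (expTerm x.1 m y).1 k) + ∑ᶠ m : ℕ, (expTerm x.1 m z).1 k
    rw [← finsum_add_distrib (expTerm_finite x.2 y k) (expTerm_finite x.2 z k)]
    exact finsum_congr fun m => by rw [map_add]; rfl)
  map_smul' c y := Subtype.ext (funext fun k => by
    change ∑ᶠ m : ℕ, (expTerm x.1 m (c • y)).1 k = c • ∑ᶠ m : ℕ, (expTerm x.1 m y).1 k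
    rw [smul_finsum]
    exact finsum_congr fun m => by rw [map_smul]; rfl)

theorem expAdEnd_sub_mem_tail (x : tail 𝒢 1) {N : ℤ} {y : completion 𝒢} (hy : y ∈ tail 𝒢 N)
    (M : ℕ) : expAdEnd x y - ∑ m ∈ Finset.range M, expTerm x.1 m y ∈ tail 𝒢 (N + M) := by
  intro k hk
  have h : (expAdEnd x y).1 k = ∑ m ∈ Finset.range M, (expTerm x.1 m y).1 k := by
    refine finsum_eq_sum_of_support_subset _ fun m hm => ?_
    by_contra h
    rw [Finset.mem_coe, Finset.mem_range] at h
    exact hm (expTerm_mem_tail x.2 hy m k (by omega))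
  change (expAdEnd x y).1 k - (∑ m ∈ Finset.range M, expTerm x.1 m y).1 k = 0
  rw [h, AddSubmonoidClass.coe_finsetSum, Finset.sum_apply, sub_self]

theorem expAdEnd_mem_tail (x : tail 𝒢 1) {N : ℤ} {y : completion 𝒢} (hy : y ∈ tail 𝒢 N) :
    expAdEnd x y ∈ tail 𝒢 N := by
  simpa using expAdEnd_sub_mem_tail x hy 0

theorem sum_square_sub_triangle {V : Type*} [AddCommGroup V] [Module ℂ V] (W : Submodule ℂ V)
    (f : ℕ → ℕ → V) (M : ℕ) (h : ∀ a b, M ≤ a + b → f a b ∈ W) :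
    (∑ a ∈ Finset.range M, ∑ b ∈ Finset.range M, f a b) -
      ∑ m ∈ Finset.range M, ∑ p ∈ Finset.HasAntidiagonal.antidiagonal m, f p.1 p.2 ∈ W := by
  have h1 : ∑ m ∈ Finset.range M, ∑ p ∈ Finset.HasAntidiagonal.antidiagonal m, f p.1 p.2 =
      ∑ a ∈ Finset.range M, ∑ b ∈ Finset.range (M - a), f a b := by
    rw [← Finset.sum_range_diag_flip]
    exact Finset.sum_congr rfl fun m _ =>
      Finset.Nat.sum_antidiagonal_eq_sum_range_succ (fun i j => f i j) m
  rw [h1, ← Finset.sum_sub_distrib]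
  refine Submodule.sum_mem _ fun a _ => ?_
  rw [← Finset.sum_range_add_sum_Ico _ (Nat.sub_le M a), add_sub_cancel_left]
  refine Submodule.sum_mem _ fun b hb => h a b ?_
  rw [Finset.mem_Ico] at hb
  omega

theorem inv_factorial_mul_choose (a b : ℕ) : (((a + b).factorial : ℂ)⁻¹ *
    ((a + b).choose b : ℂ)) = (a.factorial : ℂ)⁻¹ * (b.factorial : ℂ)⁻¹ := by
  have h := Nat.add_choose_mul_factorial_mul_factorial a b
  have ha : (a.factorial : ℂ) ≠ 0 := Nat.cast_ne_zero.mpr a.factorial_ne_zero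
  have hb : (b.factorial : ℂ) ≠ 0 := Nat.cast_ne_zero.mpr b.factorial_ne_zero
  have hc : ((a + b).factorial : ℂ) ≠ 0 := Nat.cast_ne_zero.mpr (a + b).factorial_ne_zero
  have h' := congrArg (Nat.cast : ℕ → ℂ) h
  push_cast at h'
  field_simp
  linear_combination h'

theorem expTerm_lie (x y z : completion 𝒢) (m : ℕ) : expTerm x m ⁅y, z⁆ =
    ∑ p ∈ Finset.HasAntidiagonal.antidiagonal m, ⁅expTerm x p.1 y, expTerm x p.2 z⁆ := by
  simp only [expTerm, LinearMap.smul_apply, LieAlgebra.ad_pow_lie, Finset.smul_sum]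
  refine Finset.sum_congr rfl fun p hp => ?_
  rw [smul_lie, lie_smul, smul_smul, ← Nat.cast_smul_eq_nsmul ℂ, smul_smul]
  congr 1
  rw [Finset.HasAntidiagonal.mem_antidiagonal] at hp
  rw [← hp, Nat.choose_symm_add, inv_factorial_mul_choose]

theorem expAdEnd_lie (x : tail 𝒢 1) (y z : completion 𝒢) :
    expAdEnd x ⁅y, z⁆ = ⁅expAdEnd x y, expAdEnd x z⁆ := by
  obtain ⟨N, hy⟩ := exists_mem_tail y
  obtain ⟨K, hz⟩ := exists_mem_tail z
  refine eq_of_sub_mem_tail (N + K) fun M _ => ?_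
  have h1 := expAdEnd_sub_mem_tail x (lie_mem_tail hy hz) M
  have h2 := lie_mem_tail (expAdEnd_sub_mem_tail x hy M) (expAdEnd_mem_tail x hz)
  have hs : ∑ m ∈ Finset.range M, expTerm x.1 m y ∈ tail 𝒢 N :=
    Submodule.sum_mem _ fun m _ => tail_mono (by omega) (expTerm_mem_tail x.2 hy m)
  have h3 := lie_mem_tail hs (expAdEnd_sub_mem_tail x hz M)
  have h4 := sum_square_sub_triangle (tail 𝒢 (N + K + M))
    (fun a b => ⁅expTerm x.1 a y, expTerm x.1 b z⁆) M fun a b hab =>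
      tail_mono (by omega) (lie_mem_tail (expTerm_mem_tail x.2 hy a) (expTerm_mem_tail x.2 hz b))
  simp only [← expTerm_lie] at h4
  rw [Finset.sum_comm] at h4
  rw [show N + M + K = N + K + M by ring] at h2
  rw [← add_assoc] at h3
  have h5 := sub_mem (sub_mem (sub_mem h1 h4) h2) h3
  convert h5 using 1
  simp only [sub_lie, lie_sub, sum_lie, lie_sum]
  abel

theorem sum_expTerm_neg (x y : completion 𝒢) (m : ℕ) :
    ∑ p ∈ Finset.HasAntidiagonal.antidiagonal m, expTerm x p.1 (expTerm (-x) p.2 y) =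
      if m = 0 then y else 0 := by
  have h : ∀ p ∈ Finset.HasAntidiagonal.antidiagonal m, expTerm x p.1 (expTerm (-x) p.2 y) =
      ((m.factorial : ℂ)⁻¹ * ((-1) ^ p.2 * (m.choose p.2 : ℂ))) •
        ((LieAlgebra.ad ℂ (completion 𝒢) x) ^ m) y := by
    intro p hp
    rw [Finset.HasAntidiagonal.mem_antidiagonal] at hp
    have hneg : (LieAlgebra.ad ℂ (completion 𝒢) (-x)) ^ p.2 =
        ((-1 : ℂ) ^ p.2) • (LieAlgebra.ad ℂ (completion 𝒢) x) ^ p.2 := by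
      rw [map_neg, ← neg_one_smul ℂ, smul_pow]
    simp only [expTerm, hneg, LinearMap.smul_apply, map_smul]
    rw [← hp, pow_add, Module.End.mul_apply, smul_smul, smul_smul]
    congr 1
    rw [mul_left_comm, inv_factorial_mul_choose]
    ring
  rw [Finset.sum_congr rfl h, ← Finset.sum_smul, ← Finset.mul_sum,
    Finset.Nat.sum_antidiagonal_eq_sum_range_succ_mk, ← Finset.sum_range_reflect]
  have h0 : ∑ j ∈ Finset.range (m + 1), ((-1 : ℂ) ^ (m - (m + 1 - 1 - j)) *
      (m.choose (m - (m + 1 - 1 - j)) : ℂ)) = if m = 0 then 1 else 0 := by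
    have := Int.alternating_sum_range_choose (n := m)
    have h' := congrArg (Int.cast : ℤ → ℂ) this
    push_cast at h'
    rw [← h']
    refine Finset.sum_congr rfl fun j hj => ?_
    rw [Finset.mem_range] at hj
    rw [show m - (m + 1 - 1 - j) = j by omega]
  rw [Nat.succ_eq_add_one, h0]
  by_cases hm : m = 0
  · subst hm
    simp
  · simp [hm]

theorem expAdEnd_neg (x : tail 𝒢 1) (y : completion 𝒢) : expAdEnd x (expAdEnd (-x) y) = y := by
  obtain ⟨N, hy⟩ := exists_mem_tail y
  refine eq_of_sub_mem_tail N fun M hM => ?_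
  have h1 := expAdEnd_mem_tail x (expAdEnd_sub_mem_tail (-x) hy M)
  have hs : ∑ m ∈ Finset.range M, expTerm (-x).1 m y ∈ tail 𝒢 N :=
    Submodule.sum_mem _ fun m _ => tail_mono (by omega) (expTerm_mem_tail (-x).2 hy m)
  have h2 := expAdEnd_sub_mem_tail x hs M
  have h3 := sum_square_sub_triangle (tail 𝒢 (N + M))
    (fun a b => expTerm x.1 a (expTerm (-x).1 b y)) M fun a b hab =>
      tail_mono (by omega) (expTerm_mem_tail x.2 (expTerm_mem_tail (-x).2 hy b) a)
  have h4 : ∑ m ∈ Finset.range M, ∑ p ∈ Finset.HasAntidiagonal.antidiagonal m,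
      expTerm x.1 p.1 (expTerm (-x).1 p.2 y) = y := by
    have : ∀ m ∈ Finset.range M, ∑ p ∈ Finset.HasAntidiagonal.antidiagonal m,
      expTerm x.1 p.1 (expTerm (-x).1 p.2 y) = if m = 0 then y else 0 :=
        fun m _ => sum_expTerm_neg x.1 y m
    rw [Finset.sum_congr rfl this, Finset.sum_ite_eq' (Finset.range M) 0 (fun _ => y),
      if_pos (Finset.mem_range.mpr (by omega))]
  rw [h4] at h3
  have h5 := add_mem (add_mem h1 h2) h3
  convert h5 using 1
  simp only [map_sub, map_sum]
  abel

/-- For `x` in `∏_{j ≥ 1} 𝒢 j`, the automorphism `exp (ad x)` of the completion. -/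
def expAd (x : tail 𝒢 1) : completion 𝒢 ≃ₗ⁅ℂ⁆ completion 𝒢 where
  toLinearMap := expAdEnd x
  map_lie' := expAdEnd_lie x _ _
  invFun := expAdEnd (-x)
  left_inv y := by
    have := expAdEnd_neg (-x) y
    rwa [neg_neg] at this
  right_inv y := expAdEnd_neg x y

/-- Each component `𝒢 k` (finite dimensional in the case of interest) carries its canonical vector
space topology, and the completion carries the topology induced by the product topology. -/
instance : TopologicalSpace (completion 𝒢) :=
  TopologicalSpace.induced Subtype.val
    (@Pi.topologicalSpace ℤ (fun k => 𝒢 k) fun k => moduleTopology ℂ (𝒢 k))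

/-- The automorphism group of the completion carries the topology of pointwise convergence. -/
instance : TopologicalSpace (completion 𝒢 ≃ₗ⁅ℂ⁆ completion 𝒢) :=
  TopologicalSpace.induced (fun φ => (φ : completion 𝒢 → completion 𝒢)) Pi.topologicalSpace

theorem incl_mem_tail (k : ℤ) (x : 𝒢 k) : incl 𝒢 k x ∈ tail 𝒢 k :=
  fun _ hj => Pi.single_eq_of_ne hj.ne _

/-- The automorphism `exp (ad x)` of the completion for `x` in `𝒢 ℓ`, `ℓ ≥ 1`. -/
def expAdHom (ℓ : ℕ+) (x : 𝒢 ((ℓ : ℕ) : ℤ)) : completion 𝒢 ≃ₗ⁅ℂ⁆ completion 𝒢 :=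
  expAd ⟨incl 𝒢 ((ℓ : ℕ) : ℤ) x, tail_mono (by exact_mod_cast ℓ.pos) (incl_mem_tail _ x)⟩

/-- The partial products, read from right to left: `orderedProd g n N` is
`g (n + N - 1) * ⋯ * g (n + 1) * g n`, with `N` factors. -/
def orderedProd {G : Type*} [Monoid G] (g : ℕ+ → G) (n : ℕ+) : ℕ → G
  | 0 => 1
  | N + 1 => g ⟨n + N, Nat.add_pos_left n.pos N⟩ * orderedProd g n N

/-- The automorphisms `φ` of the completion with `φ y ∈ y + ∏_{j ≥ k + n} 𝒢 j` for all `k` and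
all `y ∈ 𝒢 k`. -/
def unipotent (𝒢 : ℤ → Submodule ℂ L) [SetLike.GradedBracket 𝒢] (n : ℕ+) :
    Set (completion 𝒢 ≃ₗ⁅ℂ⁆ completion 𝒢) :=
  {φ | ∀ (k : ℤ) (y : 𝒢 k), φ (incl 𝒢 k y) - incl 𝒢 k y ∈ tail 𝒢 (k + (n : ℕ))}

end GradedLie

namespace Monster

open PowerSeries

/-- The `q`-expansion of the Eisenstein series `E₄`. -/
def eisensteinFour : PowerSeries ℤ :=
  PowerSeries.mk fun n => if n = 0 then 1 else 240 * (ArithmeticFunction.sigma 3 n : ℤ)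

/-- The infinite product `∏_{n ≥ 1} (1 - q ^ n) ^ 24`; its `m`-th coefficient is that of the
product of the factors with `n ≤ m`. -/
def eulerProduct : PowerSeries ℤ :=
  PowerSeries.mk fun m =>
    PowerSeries.coeff m (∏ n ∈ Finset.Icc 1 m, (1 - PowerSeries.X ^ n) ^ 24)

/-- The power series `q · J(q) = q · (E₄ ^ 3 / Δ - 744)`, where `Δ = q ∏ (1 - q ^ n) ^ 24`. -/
def qJ : PowerSeries ℤ :=
  eisensteinFour ^ 3 * PowerSeries.invOfUnit eulerProduct 1 - 744 * PowerSeries.X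

/-- The coefficient `c(j)` of `q ^ j` in the normalized modular function
`J(q) = q⁻¹ + 196884 q + ⋯`, for `j ≥ -1`. -/
def c (j : ℤ) : ℕ := (PowerSeries.coeff (j + 1).toNat qJ).toNat

theorem coeff_mul_three (f g : PowerSeries ℤ) {a b d a' b' d' : ℤ}
    (hf : coeff 0 f = a ∧ coeff 1 f = b ∧ coeff 2 f = d)
    (hg : coeff 0 g = a' ∧ coeff 1 g = b' ∧ coeff 2 g = d') :
    coeff 0 (f * g) = a * a' ∧ coeff 1 (f * g) = a * b' + b * a' ∧
      coeff 2 (f * g) = a * d' + b * b' + d * a' := by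
  obtain ⟨rfl, rfl, rfl⟩ := hf
  obtain ⟨rfl, rfl, rfl⟩ := hg
  simp only [coeff_mul]
  refine ⟨by simp, ?_, ?_⟩
  · simp [Finset.Nat.antidiagonal_succ]
  · simp [Finset.Nat.antidiagonal_succ]
    ring

theorem coeff_pow24 (f : PowerSeries ℤ) {b d : ℤ}
    (hf : coeff 0 f = 1 ∧ coeff 1 f = b ∧ coeff 2 f = d) :
    coeff 0 (f ^ 24) = 1 ∧ coeff 1 (f ^ 24) = 24 * b ∧
      coeff 2 (f ^ 24) = 24 * d + 276 * b ^ 2 := by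
  have h2 := coeff_mul_three f f hf hf
  have h3 := coeff_mul_three _ _ h2 hf
  have h6 := coeff_mul_three _ _ h3 h3
  have h12 := coeff_mul_three _ _ h6 h6
  have h24 := coeff_mul_three _ _ h12 h12
  have e : f ^ 24 = f * f * f * (f * f * f) * (f * f * f * (f * f * f)) *
    (f * f * f * (f * f * f) * (f * f * f * (f * f * f))) := by ring
  rw [e, h24.1, h24.2.1, h24.2.2]
  exact ⟨by ring, by ring, by ring⟩

theorem coeff_one_sub_X : coeff 0 (1 - X ^ 1 : PowerSeries ℤ) = 1 ∧
    coeff 1 (1 - X ^ 1 : PowerSeries ℤ) = -1 ∧ coeff 2 (1 - X ^ 1 : PowerSeries ℤ) = 0 := by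
  simp only [map_sub, coeff_one, coeff_X_pow]
  norm_num

theorem coeff_one_sub_X_sq : coeff 0 (1 - X ^ 2 : PowerSeries ℤ) = 1 ∧
    coeff 1 (1 - X ^ 2 : PowerSeries ℤ) = 0 ∧ coeff 2 (1 - X ^ 2 : PowerSeries ℤ) = -1 := by
  simp only [map_sub, coeff_one, coeff_X_pow]
  norm_num

theorem coeff_eulerProduct : coeff 0 eulerProduct = 1 ∧ coeff 1 eulerProduct = -24 ∧
    coeff 2 eulerProduct = 252 := by
  have h1 := coeff_pow24 _ coeff_one_sub_X
  have h2 := coeff_mul_three _ _ h1 (coeff_pow24 _ coeff_one_sub_X_sq)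
  simp only [eulerProduct, coeff_mk]
  refine ⟨by simp, ?_, ?_⟩
  · rw [Finset.Icc_self, Finset.prod_singleton, h1.2.1]
    norm_num
  · rw [show Finset.Icc 1 2 = {1, 2} by rfl, Finset.prod_pair (by norm_num), h2.2.2]
    norm_num

theorem coeff_inv_eulerProduct : coeff 0 (invOfUnit eulerProduct 1) = 1 ∧
    coeff 1 (invOfUnit eulerProduct 1) = 24 ∧ coeff 2 (invOfUnit eulerProduct 1) = 324 := by
  have h := mul_invOfUnit eulerProduct 1 (by
    rw [← coeff_zero_eq_constantCoeff_apply, coeff_eulerProduct.1]; rfl)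
  have h' := coeff_mul_three eulerProduct (invOfUnit eulerProduct 1) coeff_eulerProduct
    ⟨rfl, rfl, rfl⟩
  rw [h] at h'
  simp only [coeff_one] at h'
  obtain ⟨h0, h1, h2⟩ := h'
  simp only [one_ne_zero, OfNat.ofNat_ne_zero, if_true, if_false, one_mul] at h0 h1 h2
  exact ⟨by linarith, by linarith, by linarith⟩

theorem coeff_eisensteinFour : coeff 0 eisensteinFour = 1 ∧ coeff 1 eisensteinFour = 240 ∧
    coeff 2 eisensteinFour = 2160 := by
  simp only [eisensteinFour, coeff_mk]
  refine ⟨by simp, by simp, ?_⟩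
  rw [ArithmeticFunction.sigma_apply, show Nat.divisors 2 = {1, 2} by rfl]
  norm_num

theorem coeff_qJ : coeff 0 qJ = 1 ∧ coeff 1 qJ = 0 ∧ coeff 2 qJ = 196884 := by
  have h2 := coeff_mul_three _ _ coeff_eisensteinFour coeff_eisensteinFour
  have h3 := coeff_mul_three _ _ h2 coeff_eisensteinFour
  have h := coeff_mul_three _ _ h3 coeff_inv_eulerProduct
  have e : qJ = eisensteinFour * eisensteinFour * eisensteinFour * invOfUnit eulerProduct 1 -
      C (744 : ℤ) * X := by
    rw [qJ, show (C (744 : ℤ) : PowerSeries ℤ) = 744 from map_ofNat _ _]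
    ring
  rw [e]
  simp only [map_sub, h.1, h.2.1, h.2.2, coeff_C_mul, coeff_X]
  norm_num

theorem c_neg_one : c (-1) = 1 := by
  rw [c, show ((-1 : ℤ) + 1).toNat = 0 by rfl, coeff_qJ.1]
  rfl

theorem c_one : c 1 = 196884 := by
  rw [c, show ((1 : ℤ) + 1).toNat = 2 by rfl, coeff_qJ.2.2]
  rfl

/-- The index set `I = {(j, k) | j ∈ {-1, 1, 2, 3, …}, 1 ≤ k ≤ c(j)}`. -/
structure Index : Type where
  j : ℤ
  k : ℕ
  hj : j = -1 ∨ 1 ≤ j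
  one_le : 1 ≤ k
  le_c : k ≤ c j

/-- The index `(-1, 1)`. -/
def iNeg : Index := ⟨-1, 1, Or.inl rfl, le_rfl, c_neg_one.ge⟩

/-- The index `(1, 1)`. -/
def iOne : Index := ⟨1, 1, Or.inr le_rfl, le_rfl, by
  rw [c_one]
  norm_num⟩

/-- The Borcherds Cartan matrix `a_{jk,pq} = -(j + p)`. -/
def cartan (i l : Index) : ℤ := -(i.j + l.j)

/-- The symbols `e_{jk}`, `f_{jk}`, `h_{jk}`. -/
inductive Gen : Type
  | e (i : Index) : Gen
  | f (i : Index) : Gen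
  | h (i : Index) : Gen

/-- The free generator `e_{jk}`. -/
def fE (i : Index) : FreeLieAlgebra ℂ Gen := FreeLieAlgebra.of ℂ (Gen.e i)

/-- The free generator `f_{jk}`. -/
def fF (i : Index) : FreeLieAlgebra ℂ Gen := FreeLieAlgebra.of ℂ (Gen.f i)

/-- The free generator `h_{jk}`. -/
def fH (i : Index) : FreeLieAlgebra ℂ Gen := FreeLieAlgebra.of ℂ (Gen.h i)

/-- The defining relators of `𝔤(A)`; `ee` and `ff` are the Serre relations
`(ad e_{-1,1}) ^ j e_{jk} = 0 = (ad f_{-1,1}) ^ j f_{jk}` for `j ≥ 1`. -/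
inductive Relator : FreeLieAlgebra ℂ Gen → Prop
  | hh (i l : Index) : Relator ⁅fH i, fH l⁆
  | he (i l : Index) : Relator (⁅fH i, fE l⁆ - (cartan i l : ℂ) • fE l)
  | hf (i l : Index) : Relator (⁅fH i, fF l⁆ + (cartan i l : ℂ) • fF l)
  | ef (i : Index) : Relator (⁅fE i, fF i⁆ - fH i)
  | ef_ne (i l : Index) (h : i ≠ l) : Relator ⁅fE i, fF l⁆
  | ee (i : Index) (h : 1 ≤ i.j) :
      Relator (((LieAlgebra.ad ℂ _ (fE iNeg)) ^ i.j.toNat) (fE i))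
  | ff (i : Index) (h : 1 ≤ i.j) :
      Relator (((LieAlgebra.ad ℂ _ (fF iNeg)) ^ i.j.toNat) (fF i))

/-- The ideal of the free Lie algebra generated by the relators. -/
def relIdeal : LieIdeal ℂ (FreeLieAlgebra ℂ Gen) :=
  LieSubmodule.lieSpan ℂ (FreeLieAlgebra ℂ Gen) {x | Relator x}

/-- The Borcherds algebra `𝔤(A)`. -/
def BorcherdsAlgebra : Type := FreeLieAlgebra ℂ Gen ⧸ relIdeal

instance : LieRing BorcherdsAlgebra :=
  inferInstanceAs (LieRing (FreeLieAlgebra ℂ Gen ⧸ relIdeal))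

instance : LieAlgebra ℂ BorcherdsAlgebra :=
  inferInstanceAs (LieAlgebra ℂ (FreeLieAlgebra ℂ Gen ⧸ relIdeal))

/-- The Monster Lie algebra `𝔪`, the quotient of `𝔤(A)` by its center. -/
def MonsterLie : Type := BorcherdsAlgebra ⧸ LieAlgebra.center ℂ BorcherdsAlgebra

instance : LieRing MonsterLie :=
  inferInstanceAs (LieRing (BorcherdsAlgebra ⧸ LieAlgebra.center ℂ BorcherdsAlgebra))

instance : LieAlgebra ℂ MonsterLie :=
  inferInstanceAs (LieAlgebra ℂ (BorcherdsAlgebra ⧸ LieAlgebra.center ℂ BorcherdsAlgebra))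

/-- The quotient map onto `𝔤(A)`. -/
def toBorcherds : FreeLieAlgebra ℂ Gen →ₗ⁅ℂ⁆ BorcherdsAlgebra where
  toLinearMap := relIdeal.toSubmodule.mkQ
  map_lie' := fun {x y} => LieSubmodule.Quotient.mk_bracket _ x y

/-- The quotient map from `𝔤(A)` onto `𝔪`. -/
def toMonster : BorcherdsAlgebra →ₗ⁅ℂ⁆ MonsterLie where
  toLinearMap := (LieAlgebra.center ℂ BorcherdsAlgebra).toSubmodule.mkQ
  map_lie' := fun {x y} => LieSubmodule.Quotient.mk_bracket _ x y

/-- The image of a generator in `𝔪`. -/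
def gen (g : Gen) : MonsterLie := toMonster (toBorcherds (FreeLieAlgebra.of ℂ g))

/-- `h₁ = (h_{-1,1} - h_{1,1}) / 2`. -/
def h₁ : MonsterLie := (1 / 2 : ℂ) • (gen (Gen.h iNeg) - gen (Gen.h iOne))

/-- `h₂ = -(h_{-1,1} + h_{1,1}) / 2`. -/
def h₂ : MonsterLie := -((1 / 2 : ℂ) • (gen (Gen.h iNeg) + gen (Gen.h iOne)))

/-- The subalgebra `𝔤𝔩₂(-1)` generated by `e_{-1}`, `f_{-1}`, `h₁`, `h₂`. -/
def gl₂ : LieSubalgebra ℂ MonsterLie :=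
  LieSubalgebra.lieSpan ℂ MonsterLie {gen (Gen.e iNeg), gen (Gen.f iNeg), h₁, h₂}

/-- The weight space of `𝔪` for the Cartan subalgebra `ℂ h₁ ⊕ ℂ h₂` and the weight `(a, b)`. -/
def rootSpace (β : ℤ × ℤ) : Submodule ℂ MonsterLie where
  carrier := {x | ⁅h₁, x⁆ = (β.1 : ℂ) • x ∧ ⁅h₂, x⁆ = (β.2 : ℂ) • x}
  zero_mem' := by simp
  add_mem' := by
    rintro x y ⟨hx, hx'⟩ ⟨hy, hy'⟩
    exact ⟨by rw [lie_add, hx, hy, smul_add], by rw [lie_add, hx', hy', smul_add]⟩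
  smul_mem' := by
    rintro r x ⟨hx, hx'⟩
    exact ⟨by rw [lie_smul, hx, smul_comm], by rw [lie_smul, hx', smul_comm]⟩

/-- The homogeneous component `𝔪_k`: for `k ≠ 0` the (direct) sum of the root spaces `𝔪_{(a,b)}` with
`a + b = k`, and `𝔪_0 = 𝔤𝔩₂(-1)`. -/
def component (k : ℤ) : Submodule ℂ MonsterLie :=
  if k = 0 then gl₂.toSubmodule else ⨆ β : {β : ℤ × ℤ // β.1 + β.2 = k}, rootSpace β.1

/-! Facts needed for the bracket: the subspaces `component k` form a grading. -/

theorem rel_eq {x : FreeLieAlgebra ℂ Gen} (h : Relator x) : toMonster (toBorcherds x) = 0 := by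
  have : toBorcherds x = 0 := (Submodule.Quotient.mk_eq_zero _).mpr (LieSubmodule.subset_lieSpan h)
  rw [this, map_zero]

theorem gen_hh (i l : Index) : ⁅gen (.h i), gen (.h l)⁆ = 0 := by
  have := rel_eq (.hh i l)
  simp only [LieHom.map_lie] at this
  exact this

theorem gen_he (i l : Index) : ⁅gen (.h i), gen (.e l)⁆ = (cartan i l : ℂ) • gen (.e l) := by
  have := rel_eq (.he i l)
  simp only [map_sub, LieHom.map_lie, map_smul] at this
  exact sub_eq_zero.mp this

theorem gen_hf (i l : Index) : ⁅gen (.h i), gen (.f l)⁆ = (-(cartan i l : ℂ)) • gen (.f l) := by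
  have := rel_eq (.hf i l)
  simp only [map_add, LieHom.map_lie, map_smul] at this
  rw [neg_smul]
  exact eq_neg_of_add_eq_zero_left this

theorem gen_ef (i : Index) : ⁅gen (.e i), gen (.f i)⁆ = gen (.h i) := by
  have := rel_eq (.ef i)
  simp only [map_sub, LieHom.map_lie] at this
  exact sub_eq_zero.mp this

theorem gen_ef_ne (i l : Index) (h : i ≠ l) : ⁅gen (.e i), gen (.f l)⁆ = 0 := by
  have := rel_eq (.ef_ne i l h)
  simp only [LieHom.map_lie] at this
  exact this

theorem toBorcherds_surjective : Function.Surjective toBorcherds :=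
  Submodule.mkQ_surjective relIdeal.toSubmodule

theorem toMonster_surjective : Function.Surjective toMonster :=
  Submodule.mkQ_surjective (LieAlgebra.center ℂ BorcherdsAlgebra).toSubmodule

theorem mem_of_gens {L : Type} [LieRing L] [LieAlgebra ℂ L] (φ : FreeLieAlgebra ℂ Gen →ₗ⁅ℂ⁆ L)
    (hφ : Function.Surjective φ) (S : LieSubalgebra ℂ L)
    (h : ∀ g, φ (FreeLieAlgebra.of ℂ g) ∈ S) (x : L) : x ∈ S := by
  have : S.incl.comp (FreeLieAlgebra.lift ℂ fun g => (⟨_, h g⟩ : S)) = φ :=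
    FreeLieAlgebra.hom_ext fun g => by
      rw [LieHom.comp_apply, FreeLieAlgebra.lift_of_apply]
      rfl
  obtain ⟨y, rfl⟩ := hφ x
  rw [← this]
  exact Subtype.prop _

theorem mem_of_gens_borcherds (S : LieSubalgebra ℂ BorcherdsAlgebra)
    (h : ∀ g, toBorcherds (FreeLieAlgebra.of ℂ g) ∈ S) (x : BorcherdsAlgebra) : x ∈ S :=
  mem_of_gens toBorcherds toBorcherds_surjective S h x

theorem mem_of_gens_monster (S : LieSubalgebra ℂ MonsterLie) (h : ∀ g, gen g ∈ S)
    (x : MonsterLie) : x ∈ S :=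
  mem_of_gens (toMonster.comp toBorcherds)
    (toMonster_surjective.comp toBorcherds_surjective) S h x

/-- In `𝔪` one has `h_{jk} = -j h₁ - h₂`. -/
theorem gen_h (i : Index) : gen (.h i) = -((i.j : ℂ) • h₁) - h₂ := by
  set b : Gen → BorcherdsAlgebra := fun g => toBorcherds (FreeLieAlgebra.of ℂ g) with hb
  have rel : ∀ {x}, Relator x → toBorcherds x = 0 := fun h =>
    (Submodule.Quotient.mk_eq_zero _).mpr (LieSubmodule.subset_lieSpan h)
  have hhe : ∀ i l, ⁅b (.h i), b (.e l)⁆ = (cartan i l : ℂ) • b (.e l) := fun i l => by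
    have := rel (.he i l)
    simp only [map_sub, LieHom.map_lie, map_smul] at this
    exact sub_eq_zero.mp this
  have hhf : ∀ i l, ⁅b (.h i), b (.f l)⁆ = -((cartan i l : ℂ) • b (.f l)) := fun i l => by
    have := rel (.hf i l)
    simp only [map_add, LieHom.map_lie, map_smul] at this
    exact eq_neg_of_add_eq_zero_left this
  have hhh : ∀ i l, ⁅b (.h i), b (.h l)⁆ = 0 := fun i l => by
    have := rel (.hh i l)
    simp only [LieHom.map_lie] at this
    exact this
  set z : BorcherdsAlgebra := b (.h i) + ((i.j : ℂ) / 2) • (b (.h iNeg) - b (.h iOne))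
    - (1 / 2 : ℂ) • (b (.h iNeg) + b (.h iOne)) with hz
  have hcent : ∀ x : BorcherdsAlgebra, ⁅z, x⁆ = 0 := by
    let S : LieSubalgebra ℂ BorcherdsAlgebra :=
      { carrier := {x | ⁅z, x⁆ = 0}
        zero_mem' := lie_zero z
        add_mem' := fun {x y} hx hy => by
          change ⁅z, x + y⁆ = 0
          rw [lie_add, hx, hy, add_zero]
        smul_mem' := fun r x hx => by
          change ⁅z, r • x⁆ = 0
          rw [lie_smul, hx, smul_zero]
        lie_mem' := fun {x y} hx hy => by
          change ⁅z, ⁅x, y⁆⁆ = 0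
          rw [leibniz_lie, hx, hy, zero_lie, lie_zero, add_zero] }
    refine mem_of_gens_borcherds S fun g => ?_
    change ⁅z, b g⁆ = 0
    rw [hz, sub_lie, add_lie, smul_lie, smul_lie, sub_lie, add_lie]
    cases g with
    | e l =>
      rw [hhe, hhe, hhe, ← sub_smul, ← add_smul, smul_smul, smul_smul, ← add_smul, ← sub_smul]
      convert zero_smul ℂ (b (.e l)) using 2
      simp only [cartan, iNeg, iOne]
      push_cast
      ring
    | f l =>
      rw [hhf, hhf, hhf, ← neg_smul, ← neg_smul, ← neg_smul, ← sub_smul, ← add_smul, smul_smul,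
        smul_smul, ← add_smul, ← sub_smul]
      convert zero_smul ℂ (b (.f l)) using 2
      simp only [cartan, iNeg, iOne]
      push_cast
      ring
    | h l => simp [hhh]
  have h0 : toMonster z = 0 := by
    refine (Submodule.Quotient.mk_eq_zero _).mpr ?_
    change z ∈ LieAlgebra.center ℂ BorcherdsAlgebra
    rw [LieModule.mem_maxTrivSubmodule]
    intro x
    rw [← lie_skew, hcent, neg_zero]
  have h1 : gen (.h i) + ((i.j : ℂ) / 2) • (gen (.h iNeg) - gen (.h iOne))
    - (1 / 2 : ℂ) • (gen (.h iNeg) + gen (.h iOne)) = 0 := by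
    simp only [hz, map_sub, map_add, map_smul] at h0
    exact h0
  unfold h₁ h₂
  rw [← sub_eq_zero, ← h1, ← sub_eq_zero]
  module

/-- The sum of the weight spaces with weights `(a, b)`, `a + b = k`. -/
def weightSum (k : ℤ) : Submodule ℂ MonsterLie :=
  ⨆ β : {β : ℤ × ℤ // β.1 + β.2 = k}, rootSpace β.1

theorem rootSpace_le {β : ℤ × ℤ} {k : ℤ} (h : β.1 + β.2 = k) : rootSpace β ≤ weightSum k :=
  le_iSup (fun β : {β : ℤ × ℤ // β.1 + β.2 = k} => rootSpace β.1) ⟨β, h⟩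

theorem rootSpace_lie {β γ : ℤ × ℤ} {x y : MonsterLie} (hx : x ∈ rootSpace β)
    (hy : y ∈ rootSpace γ) : ⁅x, y⁆ ∈ rootSpace (β + γ) := by
  obtain ⟨hx, hx'⟩ := hx
  obtain ⟨hy, hy'⟩ := hy
  constructor
  · rw [leibniz_lie, hx, hy, smul_lie, lie_smul, ← add_smul, Prod.fst_add, Int.cast_add]
  · rw [leibniz_lie, hx', hy', smul_lie, lie_smul, ← add_smul, Prod.snd_add, Int.cast_add]

theorem weightSum_lie {i j : ℤ} {x y : MonsterLie} (hx : x ∈ weightSum i)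
    (hy : y ∈ weightSum j) : ⁅x, y⁆ ∈ weightSum (i + j) := by
  refine Submodule.iSup_induction _ (motive := fun x => ⁅x, y⁆ ∈ weightSum (i + j)) hx ?_ ?_ ?_
  · intro β x hx
    refine Submodule.iSup_induction _ (motive := fun y => ⁅x, y⁆ ∈ weightSum (i + j)) hy ?_ ?_ ?_
    · intro γ y hy
      refine rootSpace_le ?_ (rootSpace_lie hx hy)
      have h1 := β.2
      have h2 := γ.2
      simp only [Prod.fst_add, Prod.snd_add]
      omega
    · rw [lie_zero]
      exact zero_mem _
    · intro y z hy hz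
      rw [lie_add]
      exact add_mem hy hz
  · rw [zero_lie]
    exact zero_mem _
  · intro y z hy hz
    rw [add_lie]
    exact add_mem hy hz

theorem e_mem (i : Index) : gen (.e i) ∈ rootSpace (1, i.j) := by
  constructor
  · rw [h₁, smul_lie, sub_lie, gen_he, gen_he, ← sub_smul, smul_smul]
    congr 1
    simp only [cartan, iNeg, iOne]
    push_cast
    ring
  · rw [h₂, neg_lie, smul_lie, add_lie, gen_he, gen_he, ← add_smul, smul_smul, ← neg_smul]
    congr 1
    simp only [cartan, iNeg, iOne]
    push_cast
    ring

theorem f_mem (i : Index) : gen (.f i) ∈ rootSpace (-1, -i.j) := by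
  constructor
  · rw [h₁, smul_lie, sub_lie, gen_hf, gen_hf, ← sub_smul, smul_smul]
    congr 1
    simp only [cartan, iNeg, iOne]
    push_cast
    ring
  · rw [h₂, neg_lie, smul_lie, add_lie, gen_hf, gen_hf, ← add_smul,
      smul_smul, ← neg_smul]
    congr 1
    simp only [cartan, iNeg, iOne]
    push_cast
    ring

theorem h₁_mem : h₁ ∈ rootSpace (0, 0) := by
  constructor <;> simp [h₁, h₂, gen_hh]

theorem h₂_mem : h₂ ∈ rootSpace (0, 0) := by
  constructor <;> simp [h₁, h₂, gen_hh]

theorem gl₂_le : gl₂.toSubmodule ≤ weightSum 0 := by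
  let S : LieSubalgebra ℂ MonsterLie :=
    { weightSum 0 with lie_mem' := fun hx hy => weightSum_lie (i := 0) (j := 0) hx hy }
  refine (LieSubalgebra.lieSpan_le (K := S)).mpr fun x hx => ?_
  change x ∈ weightSum 0
  simp only [Set.mem_insert_iff, Set.mem_singleton_iff] at hx
  rcases hx with rfl | rfl | rfl | rfl
  · exact rootSpace_le (by simp [iNeg]) (e_mem iNeg)
  · exact rootSpace_le (by simp [iNeg]) (f_mem iNeg)
  · exact rootSpace_le (β := (0, 0)) (by norm_num) h₁_mem
  · exact rootSpace_le (β := (0, 0)) (by norm_num) h₂_mem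

/-- The span of `h₁` and `h₂`. -/
def cartanSub : Submodule ℂ MonsterLie := Submodule.span ℂ {h₁, h₂}

theorem gen_h_mem (i : Index) : gen (.h i) ∈ cartanSub := by
  rw [gen_h]
  have m1 : h₁ ∈ cartanSub := Submodule.subset_span (Or.inl rfl)
  have m2 : h₂ ∈ cartanSub := Submodule.subset_span (Or.inr rfl)
  exact sub_mem (neg_mem (Submodule.smul_mem _ _ m1)) m2

theorem cartan_lie {β : ℤ × ℤ} {x h : MonsterLie} (hx : x ∈ rootSpace β) (hh : h ∈ cartanSub) :
    ∃ r : ℂ, ⁅h, x⁆ = r • x := by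
  induction hh using Submodule.span_induction with
  | mem h hh =>
    rcases hh with rfl | rfl
    · exact ⟨_, hx.1⟩
    · exact ⟨_, hx.2⟩
  | zero => exact ⟨0, by simp⟩
  | add g h _ _ hg hh =>
    obtain ⟨r, hr⟩ := hg
    obtain ⟨s, hs⟩ := hh
    exact ⟨r + s, by rw [add_lie, hr, hs, add_smul]⟩
  | smul a h _ hh =>
    obtain ⟨r, hr⟩ := hh
    exact ⟨a * r, by rw [smul_lie, hr, mul_smul]⟩

theorem cartan_lie_cartan {g h : MonsterLie} (hg : g ∈ cartanSub) (hh : h ∈ cartanSub) :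
    ⁅g, h⁆ = 0 := by
  have h0 : cartanSub ≤ rootSpace (0, 0) := Submodule.span_le.mpr (by
    rintro x (rfl | rfl)
    · exact h₁_mem
    · exact h₂_mem)
  induction hg using Submodule.span_induction with
  | mem g hg =>
    rcases hg with rfl | rfl
    · simpa using (h0 hh).1
    · simpa using (h0 hh).2
  | zero => simp
  | add g g' _ _ hg hg' => rw [add_lie, hg, hg', add_zero]
  | smul a g _ hg => rw [smul_lie, hg, smul_zero]

section Triangular

variable {a b : Index → MonsterLie}

theorem cartan_lie_span (ha : ∀ i, ∃ β, a i ∈ rootSpace β) {h x : MonsterLie}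
    (hh : h ∈ cartanSub) (hx : x ∈ LieSubalgebra.lieSpan ℂ MonsterLie (Set.range a)) :
    ⁅h, x⁆ ∈ LieSubalgebra.lieSpan ℂ MonsterLie (Set.range a) := by
  induction hx using LieSubalgebra.lieSpan_induction with
  | mem x hx =>
    obtain ⟨i, rfl⟩ := hx
    obtain ⟨β, hβ⟩ := ha i
    obtain ⟨r, hr⟩ := cartan_lie hβ hh
    rw [hr]
    exact LieSubalgebra.smul_mem _ _ (LieSubalgebra.subset_lieSpan ⟨i, rfl⟩)
  | zero =>
    rw [lie_zero]
    exact zero_mem _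
  | add x y _ _ hx hy =>
    rw [lie_add]
    exact add_mem hx hy
  | smul r x _ hx =>
    rw [lie_smul]
    exact LieSubalgebra.smul_mem _ _ hx
  | lie x y hx' hy' hx hy =>
    rw [leibniz_lie]
    exact add_mem (LieSubalgebra.lie_mem _ hx hy') (LieSubalgebra.lie_mem _ hx' hy)

theorem opposite_lie_span (ha : ∀ i, ∃ β, a i ∈ rootSpace β)
    (hab : ∀ i l, ⁅b i, a l⁆ ∈ cartanSub) (i : Index) {x : MonsterLie}
    (hx : x ∈ LieSubalgebra.lieSpan ℂ MonsterLie (Set.range a)) :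
    ⁅b i, x⁆ ∈ cartanSub ⊔ (LieSubalgebra.lieSpan ℂ MonsterLie (Set.range a)).toSubmodule := by
  have key : ∀ u y, u ∈ cartanSub ⊔
      (LieSubalgebra.lieSpan ℂ MonsterLie (Set.range a)).toSubmodule →
      y ∈ LieSubalgebra.lieSpan ℂ MonsterLie (Set.range a) →
      ⁅u, y⁆ ∈ LieSubalgebra.lieSpan ℂ MonsterLie (Set.range a) := by
    intro u y hu hy
    obtain ⟨h, hh, n, hn, rfl⟩ := Submodule.mem_sup.mp hu
    rw [add_lie]
    exact add_mem (cartan_lie_span ha hh hy) (LieSubalgebra.lie_mem _ hn hy)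
  induction hx using LieSubalgebra.lieSpan_induction with
  | mem x hx =>
    obtain ⟨l, rfl⟩ := hx
    exact Submodule.mem_sup_left (hab i l)
  | zero =>
    rw [lie_zero]
    exact zero_mem _
  | add x y _ _ hx hy =>
    rw [lie_add]
    exact add_mem hx hy
  | smul r x _ hx =>
    rw [lie_smul]
    exact Submodule.smul_mem _ _ hx
  | lie x y hx' hy' hx hy =>
    rw [leibniz_lie, ← lie_skew x]
    exact Submodule.mem_sup_right (add_mem (key _ _ hx hy') (neg_mem (key _ _ hy hx')))

theorem lie_triangular (ha : ∀ i, ∃ β, a i ∈ rootSpace β) (hb : ∀ i, ∃ β, b i ∈ rootSpace β)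
    (hba : ∀ i l, ⁅b i, a l⁆ ∈ cartanSub) (i : Index) {x : MonsterLie}
    (hx : x ∈ cartanSub ⊔ (LieSubalgebra.lieSpan ℂ MonsterLie (Set.range a)).toSubmodule ⊔
      (LieSubalgebra.lieSpan ℂ MonsterLie (Set.range b)).toSubmodule) :
    ⁅b i, x⁆ ∈ cartanSub ⊔ (LieSubalgebra.lieSpan ℂ MonsterLie (Set.range a)).toSubmodule ⊔
      (LieSubalgebra.lieSpan ℂ MonsterLie (Set.range b)).toSubmodule := by
  have hbi : b i ∈ LieSubalgebra.lieSpan ℂ MonsterLie (Set.range b) :=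
    LieSubalgebra.subset_lieSpan ⟨i, rfl⟩
  obtain ⟨u, hu, p, hp, rfl⟩ := Submodule.mem_sup.mp hx
  obtain ⟨h, hh, n, hn, rfl⟩ := Submodule.mem_sup.mp hu
  rw [lie_add, lie_add]
  refine add_mem (add_mem ?_ ?_) ?_
  · rw [← lie_skew]
    exact Submodule.mem_sup_right (neg_mem (cartan_lie_span hb hh hbi))
  · exact Submodule.mem_sup_left (opposite_lie_span ha hba i hn)
  · exact Submodule.mem_sup_right (LieSubalgebra.lie_mem _ hbi hp)

/-- A one-sided part of the triangular decomposition consists of multiples of the generator of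
degree zero and elements of nonzero degree of the same sign. -/
theorem span_le_sided (s : ℤ)
    (ha : ∀ i, a i ∈ weightSum (s * (i.j + 1))) (hs : s * s = 1) :
    (LieSubalgebra.lieSpan ℂ MonsterLie (Set.range a)).toSubmodule ≤
      Submodule.span ℂ {a iNeg} ⊔ ⨆ k : {k : ℤ // 1 ≤ s * k}, weightSum k.1 := by
  set Q := ⨆ k : {k : ℤ // 1 ≤ s * k}, weightSum k.1 with hQ
  have hle : ∀ k : ℤ, 1 ≤ s * k → weightSum k ≤ Q := fun k hk =>
    le_iSup (fun k : {k : ℤ // 1 ≤ s * k} => weightSum k.1) ⟨k, hk⟩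
  have ha0 : a iNeg ∈ weightSum 0 := by simpa [iNeg] using ha iNeg
  have hQ0 : ∀ (j : ℤ), 0 ≤ s * j → ∀ u ∈ weightSum j, ∀ q ∈ Q, ⁅u, q⁆ ∈ Q := by
    intro j hj u hu q hq
    refine Submodule.iSup_induction _ (motive := fun q => ⁅u, q⁆ ∈ Q) hq ?_ ?_ ?_
    · intro k x hx
      refine hle (j + k.1) ?_ (weightSum_lie hu hx)
      have := k.2
      rw [mul_add]
      omega
    · rw [lie_zero]
      exact zero_mem _
    · intro x y hx hy
      rw [lie_add]
      exact add_mem hx hy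
  have hQQ : ∀ u ∈ Q, ∀ q ∈ Q, ⁅u, q⁆ ∈ Q := by
    intro u hu q hq
    refine Submodule.iSup_induction _ (motive := fun u => ⁅u, q⁆ ∈ Q) hu ?_ ?_ ?_
    · intro k x hx
      exact hQ0 k.1 (by have := k.2; omega) x hx q hq
    · rw [zero_lie]
      exact zero_mem _
    · intro x y hx hy
      rw [add_lie]
      exact add_mem hx hy
  let S : LieSubalgebra ℂ MonsterLie :=
    { Submodule.span ℂ {a iNeg} ⊔ Q with
      lie_mem' := by
        intro x y hx hy
        obtain ⟨x', hx', q, hq, rfl⟩ := Submodule.mem_sup.mp hx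
        obtain ⟨y', hy', p, hp, rfl⟩ := Submodule.mem_sup.mp hy
        obtain ⟨r, rfl⟩ := Submodule.mem_span_singleton.mp hx'
        obtain ⟨t, rfl⟩ := Submodule.mem_span_singleton.mp hy'
        refine Submodule.mem_sup_right ?_
        rw [add_lie, lie_add, lie_add, smul_lie, lie_smul, lie_self, smul_zero, smul_zero,
          zero_add, smul_lie, lie_smul]
        refine add_mem (Submodule.smul_mem _ _ (hQ0 0 (by simp) _ ha0 _ hp))
          (add_mem (Submodule.smul_mem _ _ ?_) (hQQ _ hq _ hp))
        rw [← lie_skew]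
        exact neg_mem (hQ0 0 (by simp) _ ha0 _ hq) }
  refine (LieSubalgebra.lieSpan_le (K := S)).mpr ?_
  rintro _ ⟨i, rfl⟩
  obtain ⟨j, k, hj, hk, hk'⟩ := i
  rcases hj with hj | hj
  · subst hj
    have hk2 := hk'
    rw [c_neg_one] at hk2
    obtain rfl : k = 1 := by omega
    exact Submodule.mem_sup_left (Submodule.mem_span_singleton_self _)
  · refine Submodule.mem_sup_right (hle _ ?_ (ha _))
    change 1 ≤ s * (s * (j + 1))
    rw [← mul_assoc, hs]
    omega

end Triangular

theorem triangular (x : MonsterLie) : x ∈ cartanSub ⊔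
    (LieSubalgebra.lieSpan ℂ MonsterLie (Set.range fun i => gen (.e i))).toSubmodule ⊔
    (LieSubalgebra.lieSpan ℂ MonsterLie (Set.range fun i => gen (.f i))).toSubmodule := by
  set T := cartanSub ⊔
    (LieSubalgebra.lieSpan ℂ MonsterLie (Set.range fun i => gen (.e i))).toSubmodule ⊔
    (LieSubalgebra.lieSpan ℂ MonsterLie (Set.range fun i => gen (.f i))).toSubmodule with hT
  have he : ∀ i, ∃ β, gen (.e i) ∈ rootSpace β := fun i => ⟨_, e_mem i⟩
  have hf : ∀ i, ∃ β, gen (.f i) ∈ rootSpace β := fun i => ⟨_, f_mem i⟩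
  have hef : ∀ i l, ⁅gen (.e i), gen (.f l)⁆ ∈ cartanSub := by
    intro i l
    by_cases h : i = l
    · subst h
      rw [gen_ef]
      exact gen_h_mem i
    · rw [gen_ef_ne i l h]
      exact zero_mem _
  have hfe : ∀ i l, ⁅gen (.f i), gen (.e l)⁆ ∈ cartanSub := fun i l => by
    rw [← lie_skew]
    exact neg_mem (hef l i)
  have hinv : ∀ g, ∀ t ∈ T, ⁅gen g, t⁆ ∈ T := by
    intro g t ht
    cases g with
    | f i => exact lie_triangular he hf hfe i ht
    | e i =>
      rw [hT, sup_right_comm] at ht ⊢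
      exact lie_triangular hf he hef i ht
    | h i =>
      obtain ⟨u, hu, p, hp, rfl⟩ := Submodule.mem_sup.mp ht
      obtain ⟨h, hh, n, hn, rfl⟩ := Submodule.mem_sup.mp hu
      rw [lie_add, lie_add, cartan_lie_cartan (gen_h_mem i) hh, zero_add]
      exact add_mem
        (Submodule.mem_sup_left (Submodule.mem_sup_right (cartan_lie_span he (gen_h_mem i) hn)))
        (Submodule.mem_sup_right (cartan_lie_span hf (gen_h_mem i) hp))
  let S : LieSubalgebra ℂ MonsterLie :=
    { carrier := {x | ∀ t ∈ T, ⁅x, t⁆ ∈ T}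
      zero_mem' := fun t _ => by
        rw [zero_lie]
        exact zero_mem _
      add_mem' := fun {x y} hx hy t ht => by
        rw [add_lie]
        exact add_mem (hx t ht) (hy t ht)
      smul_mem' := fun r x hx t ht => by
        rw [smul_lie]
        exact Submodule.smul_mem _ _ (hx t ht)
      lie_mem' := fun {x y} hx hy t ht => by
        rw [lie_lie]
        exact sub_mem (hx _ (hy t ht)) (hy _ (hx t ht)) }
  have hS : ∀ x, x ∈ S := mem_of_gens_monster S hinv
  let T' : LieSubalgebra ℂ MonsterLie := { T with lie_mem' := fun {x y} _ hy => hS x y hy }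
  refine mem_of_gens_monster T' (fun g => ?_) x
  change gen g ∈ T
  cases g with
  | e i =>
    exact Submodule.mem_sup_left (Submodule.mem_sup_right (LieSubalgebra.subset_lieSpan ⟨i, rfl⟩))
  | f i => exact Submodule.mem_sup_right (LieSubalgebra.subset_lieSpan ⟨i, rfl⟩)
  | h i => exact Submodule.mem_sup_left (Submodule.mem_sup_left (gen_h_mem i))

theorem weightSum_le_eigenspace (k : ℤ) :
    weightSum k ≤ Module.End.eigenspace (LieAlgebra.ad ℂ MonsterLie (h₁ + h₂)) (k : ℂ) := by
  refine iSup_le fun β x hx => ?_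
  rw [Module.End.mem_eigenspace_iff, LieAlgebra.ad_apply, add_lie, hx.1, hx.2, ← add_smul]
  congr 1
  exact_mod_cast β.2

theorem weightSum_zero : weightSum 0 = gl₂.toSubmodule := by
  refine le_antisymm (fun x hx => ?_) gl₂_le
  have hgen : ∀ y ∈ ({gen (Gen.e iNeg), gen (Gen.f iNeg), h₁, h₂} : Set MonsterLie),
      y ∈ gl₂.toSubmodule := fun y hy => LieSubalgebra.subset_lieSpan hy
  have hH : cartanSub ≤ gl₂.toSubmodule := Submodule.span_le.mpr (by
    rintro y (rfl | rfl)
    · exact hgen _ (by simp)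
    · exact hgen _ (by simp))
  obtain ⟨u, hu, p, hp, rfl⟩ := Submodule.mem_sup.mp (triangular x)
  obtain ⟨h, hh, n, hn, rfl⟩ := Submodule.mem_sup.mp hu
  have hn' := span_le_sided (a := fun i => gen (.e i)) 1
    (fun i => rootSpace_le (by ring) (e_mem i)) (by norm_num) hn
  have hp' := span_le_sided (a := fun i => gen (.f i)) (-1)
    (fun i => rootSpace_le (by ring) (f_mem i)) (by norm_num) hp
  obtain ⟨n1, hn1, n2, hn2, rfl⟩ := Submodule.mem_sup.mp hn'
  obtain ⟨p1, hp1, p2, hp2, rfl⟩ := Submodule.mem_sup.mp hp'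
  have hn1 : n1 ∈ gl₂.toSubmodule := by
    refine Submodule.span_le.mpr ?_ hn1
    rintro y rfl
    exact hgen _ (by simp)
  have hp1 : p1 ∈ gl₂.toSubmodule := by
    refine Submodule.span_le.mpr ?_ hp1
    rintro y rfl
    exact hgen _ (by simp)
  have hg : h + n1 + p1 ∈ gl₂.toSubmodule := add_mem (add_mem (hH hh) hn1) hp1
  have hq0 : n2 + p2 ∈ Module.End.eigenspace (LieAlgebra.ad ℂ MonsterLie (h₁ + h₂)) 0 := by
    have := sub_mem hx (gl₂_le hg)
    rw [show h + (n1 + n2) + (p1 + p2) - (h + n1 + p1) = n2 + p2 by abel] at this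
    simpa using weightSum_le_eigenspace 0 this
  have hsided : ∀ s : ℤ, (⨆ k : {k : ℤ // 1 ≤ s * k}, weightSum k.1) ≤
      ⨆ (μ : ℂ) (_ : μ ≠ 0), Module.End.eigenspace (LieAlgebra.ad ℂ MonsterLie (h₁ + h₂)) μ := by
    intro s
    refine iSup_le fun k => (weightSum_le_eigenspace k.1).trans ?_
    refine le_iSup₂_of_le (k.1 : ℂ) ?_ le_rfl
    have := k.2
    rintro h0
    have h0 : k.1 = 0 := by exact_mod_cast h0
    rw [h0] at this
    omega
  have hq1 := add_mem (hsided 1 hn2) (hsided (-1) hp2)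
  have hq : n2 + p2 = 0 := (Submodule.disjoint_def.mp
    (Module.End.eigenspaces_iSupIndep (LieAlgebra.ad ℂ MonsterLie (h₁ + h₂)) 0)) _ hq0 hq1
  have : h + (n1 + n2) + (p1 + p2) = (h + n1 + p1) + (n2 + p2) := by abel
  rw [this, hq, add_zero]
  exact hg

theorem component_eq (k : ℤ) : component k = weightSum k := by
  unfold component
  split_ifs with h
  · rw [h, weightSum_zero]
  · rfl

instance : SetLike.GradedBracket component where
  bracket_mem {i j x y} hx hy := by
    rw [component_eq] at *
    exact weightSum_lie hx hy

/-- The positive formal completion `𝔪̂` of the Monster Lie algebra. -/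
abbrev MonsterHat : Type := GradedLie.completion component

/-- The automorphism group of `𝔪̂`. -/
abbrev AutHat : Type := MonsterHat ≃ₗ⁅ℂ⁆ MonsterHat

/-- The subset `Û⁺_n` of `Aut 𝔪̂`. -/
def Uhat (n : ℕ+) : Set AutHat := GradedLie.unipotent component n

/-- For `x ∈ 𝔪_ℓ`, `ℓ ≥ 1`, the automorphism `exp (ad x)` of `𝔪̂`. -/
def expAd (ℓ : ℕ+) (x : component ((ℓ : ℕ) : ℤ)) : AutHat := GradedLie.expAdHom ℓ x

/-- The partial product `exp (ad x_{n + N - 1}) ⋯ exp (ad x_{n + 1}) exp (ad x_n)`. -/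
def partialProd (x : ∀ ℓ : ℕ+, component ((ℓ : ℕ) : ℤ)) (n : ℕ+) (N : ℕ) : AutHat :=
  GradedLie.orderedProd (fun ℓ => expAd ℓ (x ℓ)) n N

end Monster

end

/-! The argument works for any graded Lie algebra `𝒢` with an element `h` of degree zero acting on
`𝒢 k` as multiplication by `k`; in the Monster Lie algebra `h = h₁ + h₂`. The point is that a
unipotent automorphism is determined by its value on `h`.

Uniqueness (`eq_one_of_fixes_degree`): an automorphism fixing `h` commutes with `ad h`, so it
preserves the eigenspaces `𝒢 k`. If it is also unipotent, it is the identity on each of them.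
Automorphisms are not assumed continuous, so passing to infinite sums needs
`map_mem_tail_of_fixes_degree`: fixing `h` already forces every tail to be preserved.

Existence (`exists_orderedProd_degree`): for `x` of degree `ℓ` and `v` equal to `h` up to positive
degree, `exp (ad x) v` agrees with `v - ℓ x` through degree `ℓ`. Since `ℓ` is invertible, the
discrepancy with `φ h` can be removed one degree at a time, which produces the `x_ℓ`. The resulting
infinite product `ψ` converges (`exists_limit_orderedProd`) and satisfies `ψ h = φ h`, so `ψ⁻¹ φ` is
trivial by uniqueness.

Limits of products lie in `filteredSubgroup`, a stronger form of unipotence that controls all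
elements of each tail as well as the inverse, and is visibly a group. The two notions therefore
coincide. The closure statement follows because unipotence is a closed condition and partial
products lie in the generated subgroup. -/

namespace GradedLie

open Filter

variable {L : Type*} [LieRing L] [LieAlgebra ℂ L] {𝒢 : ℤ → Submodule ℂ L}

/-! ### Convergence along the degree filtration -/

theorem sub_apply (x y : completion 𝒢) (k : ℤ) : (x - y).1 k = x.1 k - y.1 k := rfl

theorem sub_mem_tail_iff {x y : completion 𝒢} {K : ℤ} :
    x - y ∈ tail 𝒢 K ↔ ∀ k < K, x.1 k = y.1 k :=
  forall₂_congr fun k _ => by rw [sub_apply, sub_eq_zero]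

/-- Convergence in the completion for the topology given by the subspaces `tail 𝒢 K`. -/
def ProTendsto (f : ℕ → completion 𝒢) (z : completion 𝒢) : Prop :=
  ∀ K : ℤ, ∃ N₀, ∀ N ≥ N₀, f N - z ∈ tail 𝒢 K

namespace ProTendsto

variable {f g : ℕ → completion 𝒢} {y z : completion 𝒢}

theorem unique (hy : ProTendsto f y) (hz : ProTendsto f z) : y = z := by
  refine eq_of_sub_mem_tail 0 fun M _ => ?_
  obtain ⟨N₁, h₁⟩ := hy (0 + M)
  obtain ⟨N₂, h₂⟩ := hz (0 + M)
  simpa using sub_mem (h₂ _ (le_max_right N₁ N₂)) (h₁ _ (le_max_left N₁ N₂))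

theorem add (hf : ProTendsto f y) (hg : ProTendsto g z) :
    ProTendsto (fun N => f N + g N) (y + z) := by
  intro K
  obtain ⟨N₁, h₁⟩ := hf K
  obtain ⟨N₂, h₂⟩ := hg K
  refine ⟨max N₁ N₂, fun N hN => ?_⟩
  rw [add_sub_add_comm]
  exact add_mem (h₁ _ (le_of_max_le_left hN)) (h₂ _ (le_of_max_le_right hN))

theorem const_smul (c : ℂ) (hf : ProTendsto f y) : ProTendsto (fun N => c • f N) (c • y) := by
  intro K
  obtain ⟨N₁, h₁⟩ := hf K
  refine ⟨N₁, fun N hN => ?_⟩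
  rw [show c • f N - c • y = c • (f N - y) from (smul_sub _ _ _).symm]
  exact Submodule.smul_mem _ _ (h₁ N hN)

theorem mem_tail {K : ℤ} (hf : ProTendsto f y) (h : ∀ N, f N ∈ tail 𝒢 K) : y ∈ tail 𝒢 K := by
  obtain ⟨N₁, h₁⟩ := hf K
  simpa using sub_mem (h N₁) (h₁ N₁ le_rfl)

/-- The common lower bound `M` on degrees is what makes the bracket continuous here: an error in
degrees at least `K - M`, bracketed with an element of `tail 𝒢 M`, lands in `tail 𝒢 K`. -/
theorem lie [SetLike.GradedBracket 𝒢] {M : ℤ} (hf : ProTendsto f y) (hg : ProTendsto g z)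
    (hfM : ∀ N, f N ∈ tail 𝒢 M) (hz : z ∈ tail 𝒢 M) :
    ProTendsto (fun N => ⁅f N, g N⁆) ⁅y, z⁆ := by
  intro K
  obtain ⟨N₁, h₁⟩ := hf (K - M)
  obtain ⟨N₂, h₂⟩ := hg (K - M)
  refine ⟨max N₁ N₂, fun N hN => ?_⟩
  have e : ⁅f N, g N⁆ - ⁅y, z⁆ = ⁅f N, g N - z⁆ + ⁅f N - y, z⁆ := by
    rw [lie_sub, sub_lie]
    abel
  rw [e]
  exact add_mem (tail_mono (by omega) (lie_mem_tail (hfM N) (h₂ _ (le_of_max_le_right hN))))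
    (tail_mono (by omega) (lie_mem_tail (h₁ _ (le_of_max_le_left hN)) hz))

end ProTendsto

/-- Completeness: a sequence with consecutive differences tending to zero converges. -/
theorem exists_proTendsto {f : ℕ → completion 𝒢} {M : ℤ} (hM : ∀ N, f N ∈ tail 𝒢 M)
    (h : ∀ K : ℤ, ∃ N₀, ∀ N ≥ N₀, f (N + 1) - f N ∈ tail 𝒢 K) : ∃ z, ProTendsto f z := by
  choose N₀ hN₀ using h
  have hc : ∀ K N, N₀ K ≤ N → ∀ N', N ≤ N' → f N' - f N ∈ tail 𝒢 K := by
    intro K N hN N' hN'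
    induction N', hN' using Nat.le_induction with
    | base => simp
    | succ m hm ih =>
      rw [← sub_add_sub_cancel]
      exact add_mem (hN₀ K m (hN.trans hm)) ih
  -- Coordinate `k` is read off at the index for `tail 𝒢 (k + 1)`, from which on it no longer
  -- changes. The uniform bound `M` keeps the limit inside the completion.
  refine ⟨⟨fun k => (f (N₀ (k + 1))).1 k, M, fun k hk => hM _ k hk⟩, fun K => ⟨N₀ K, ?_⟩⟩
  intro N hN
  refine sub_mem_tail_iff.mpr fun k hk => ?_
  have h1 := sub_mem_tail_iff.mp (hc K N hN _ (le_max_left N (N₀ (k + 1)))) k hk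
  have h2 := sub_mem_tail_iff.mp (hc (k + 1) _ le_rfl _ (le_max_right N (N₀ (k + 1)))) k (by omega)
  exact h1.symm.trans h2

/-! ### The product topology and pointwise convergence -/

section Topology

/-- Linear functionals are continuous for the module topology and separate points, so finite
dimensionality plays no role. -/
theorem t2Space_moduleTopology (V : Type*) [AddCommGroup V] [Module ℂ V] :
    @T2Space V (moduleTopology ℂ V) := by
  let _ : TopologicalSpace V := moduleTopology ℂ V
  have : IsModuleTopology ℂ V := ⟨rfl⟩
  refine T2Space.of_injective_continuous (f := fun (v : V) (l : Module.Dual ℂ V) => l v) ?_ ?_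
  · intro v w h
    exact (Module.forall_dual_apply_eq_zero_iff ℂ (v - w)).mp (fun l => by
      rw [map_sub, sub_eq_zero]
      exact congrFun h l) |> sub_eq_zero.mp
  · exact continuous_pi fun l => IsModuleTopology.continuous_of_linearMap l

theorem continuous_coord (k : ℤ) : @Continuous _ _ _ (moduleTopology ℂ (𝒢 k))
    (fun y : completion 𝒢 => y.1 k) := by
  let _ : ∀ k, TopologicalSpace (𝒢 k) := fun k => moduleTopology ℂ (𝒢 k)
  exact (continuous_apply k).comp continuous_induced_dom

instance : T2Space (completion 𝒢) := by
  let _ : ∀ k, TopologicalSpace (𝒢 k) := fun k => moduleTopology ℂ (𝒢 k)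
  have : ∀ k, T2Space (𝒢 k) := fun k => t2Space_moduleTopology _
  exact T2Space.of_injective_continuous Subtype.val_injective continuous_induced_dom

theorem isClosed_tail (K : ℤ) : IsClosed (tail 𝒢 K : Set (completion 𝒢)) := by
  let _ : ∀ k, TopologicalSpace (𝒢 k) := fun k => moduleTopology ℂ (𝒢 k)
  have : ∀ k, T2Space (𝒢 k) := fun k => t2Space_moduleTopology _
  have h : (tail 𝒢 K : Set (completion 𝒢)) = ⋂ (k : ℤ) (_ : k < K), {y | y.1 k = 0} := by
    ext y
    simp only [Set.mem_iInter]
    rfl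
  rw [h]
  exact isClosed_biInter fun k _ => isClosed_eq (continuous_coord k) continuous_const

/-- Each coordinate is eventually constant, so convergence holds whatever topology the components
carry. -/
theorem ProTendsto.tendsto {f : ℕ → completion 𝒢} {z : completion 𝒢} (h : ProTendsto f z) :
    Tendsto f atTop (nhds z) := by
  let _ : ∀ k, TopologicalSpace (𝒢 k) := fun k => moduleTopology ℂ (𝒢 k)
  rw [nhds_induced, tendsto_comap_iff, tendsto_pi_nhds]
  intro k
  obtain ⟨N₀, hN₀⟩ := h (k + 1)
  refine tendsto_const_nhds.congr' ?_
  filter_upwards [eventually_ge_atTop N₀] with N hN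
  exact (sub_mem_tail_iff.mp (hN₀ N hN) k (by omega)).symm

theorem continuous_sub_right (z : completion 𝒢) : Continuous fun y : completion 𝒢 => y - z := by
  let _ : ∀ k, TopologicalSpace (𝒢 k) := fun k => moduleTopology ℂ (𝒢 k)
  have : ∀ k, IsModuleTopology ℂ (𝒢 k) := fun k => ⟨rfl⟩
  have : ∀ k, IsTopologicalAddGroup (𝒢 k) := fun k =>
    IsModuleTopology.topologicalAddGroup ℂ (𝒢 k)
  refine continuous_induced_rng.mpr (continuous_pi fun k => ?_)
  exact (continuous_coord k).sub continuous_const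

variable [SetLike.GradedBracket 𝒢]

theorem continuous_eval (y : completion 𝒢) :
    Continuous fun φ : completion 𝒢 ≃ₗ⁅ℂ⁆ completion 𝒢 => φ y :=
  (continuous_apply y).comp continuous_induced_dom

instance : T2Space (completion 𝒢 ≃ₗ⁅ℂ⁆ completion 𝒢) :=
  T2Space.of_injective_continuous (fun _ _ h => LieEquiv.ext (congrFun h)) continuous_induced_dom

theorem tendsto_aut {g : ℕ → completion 𝒢 ≃ₗ⁅ℂ⁆ completion 𝒢}
    {φ : completion 𝒢 ≃ₗ⁅ℂ⁆ completion 𝒢} (h : ∀ y, ProTendsto (fun N => g N y) (φ y)) :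
    Tendsto g atTop (nhds φ) := by
  rw [nhds_induced, tendsto_comap_iff, tendsto_pi_nhds]
  exact fun y => (h y).tendsto

/-- Unipotence is an intersection of conditions on single values `φ (incl 𝒢 k y)`, each asking for
membership in a closed tail. -/
theorem isClosed_unipotent (n : ℕ+) : IsClosed (unipotent 𝒢 n) := by
  have h : unipotent 𝒢 n = ⋂ (k : ℤ) (y : 𝒢 k),
      {φ | φ (incl 𝒢 k y) - incl 𝒢 k y ∈ (tail 𝒢 (k + (n : ℕ)) : Set (completion 𝒢))} := by
    ext φ
    simp only [Set.mem_iInter]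
    rfl
  rw [h]
  exact isClosed_iInter fun k => isClosed_iInter fun y =>
    (isClosed_tail _).preimage ((continuous_sub_right _).comp (continuous_eval _))

end Topology

/-! ### Automorphisms compatible with the filtration -/

variable [SetLike.GradedBracket 𝒢]

variable (𝒢) in
/-- The automorphisms `φ` such that `φ` and `φ⁻¹` move every element of `∏_{j ≥ M} 𝒢 j` by an
element of `∏_{j ≥ M + n} 𝒢 j`. -/
def filteredSubgroup (n : ℕ) : Subgroup (completion 𝒢 ≃ₗ⁅ℂ⁆ completion 𝒢) where
  carrier := {φ | ∀ M : ℤ, ∀ y ∈ tail 𝒢 M, φ y - y ∈ tail 𝒢 (M + n) ∧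
    φ.symm y - y ∈ tail 𝒢 (M + n)}
  one_mem' M y _ := by
    change y - y ∈ _ ∧ y - y ∈ _
    simp
  inv_mem' h M y hy := (h M y hy).symm
  mul_mem' {φ ψ} hφ hψ M y hy := by
    have aux : ∀ {w z : completion 𝒢}, z ∈ tail 𝒢 M → w - z ∈ tail 𝒢 (M + n) → w ∈ tail 𝒢 M :=
      fun hz hw => by simpa using add_mem (tail_mono (by omega) hw) hz
    constructor
    · have h := (hψ M y hy).1
      change φ (ψ y) - y ∈ _
      rw [← sub_add_sub_cancel _ (ψ y)]
      exact add_mem (hφ M _ (aux hy h)).1 h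
    · have h := (hφ M y hy).2
      change ψ.symm (φ.symm y) - y ∈ _
      rw [← sub_add_sub_cancel _ (φ.symm y)]
      exact add_mem (hψ M _ (aux hy h)).2 h

section Filtered

variable {n m : ℕ} {φ : completion 𝒢 ≃ₗ⁅ℂ⁆ completion 𝒢} {M : ℤ} {y : completion 𝒢}

theorem filteredSubgroup_mono (h : n ≤ m) : filteredSubgroup 𝒢 m ≤ filteredSubgroup 𝒢 n :=
  fun _ hφ M y hy => ⟨tail_mono (by omega) (hφ M y hy).1, tail_mono (by omega) (hφ M y hy).2⟩

theorem filtered_sub_mem (hφ : φ ∈ filteredSubgroup 𝒢 n) (hy : y ∈ tail 𝒢 M) :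
    φ y - y ∈ tail 𝒢 (M + n) := (hφ M y hy).1

theorem filtered_mem (hφ : φ ∈ filteredSubgroup 𝒢 n) (hy : y ∈ tail 𝒢 M) : φ y ∈ tail 𝒢 M := by
  simpa using add_mem (tail_mono (by omega) (filtered_sub_mem hφ hy)) hy

theorem filteredSubgroup_le_unipotent (n : ℕ+) :
    (filteredSubgroup 𝒢 n : Set (completion 𝒢 ≃ₗ⁅ℂ⁆ completion 𝒢)) ⊆ unipotent 𝒢 n :=
  fun _ hφ k y => filtered_sub_mem hφ (incl_mem_tail k y)

end Filtered

/-! ### Degree estimates for exponentials -/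

section Exp

theorem expTerm_mem_tail_of_mem {x : completion 𝒢} {ℓ N : ℤ} (hx : x ∈ tail 𝒢 ℓ)
    {y : completion 𝒢} (hy : y ∈ tail 𝒢 N) (m : ℕ) : expTerm x m y ∈ tail 𝒢 (N + m * ℓ) := by
  refine Submodule.smul_mem _ _ ?_
  induction m with
  | zero => simpa using hy
  | succ m ih =>
    rw [pow_succ', Module.End.mul_apply, LieAlgebra.ad_apply]
    refine tail_mono (le_of_eq ?_) (lie_mem_tail hx ih)
    push_cast
    ring

/-- Each factor `ad x` raises degrees by at least `ℓ`, not merely by one, so the omitted terms start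
in degree `N + M * ℓ`. The truncations `M = 1` and `M = 2` are the ones used below. -/
theorem expAdEnd_sub_mem_tail_of_mem (x : tail 𝒢 1) {ℓ : ℕ} (hx : x.1 ∈ tail 𝒢 ℓ) {N : ℤ}
    {y : completion 𝒢} (hy : y ∈ tail 𝒢 N) (M : ℕ) :
    expAdEnd x y - ∑ m ∈ Finset.range M, expTerm x.1 m y ∈ tail 𝒢 (N + M * ℓ) := by
  refine sub_mem_tail_iff.mpr fun k hk => ?_
  rw [AddSubmonoidClass.coe_finsetSum, Finset.sum_apply]
  refine finsum_eq_sum_of_support_subset _ fun m hm => ?_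
  by_contra h
  rw [Finset.mem_coe, Finset.mem_range, not_lt] at h
  refine hm (expTerm_mem_tail_of_mem hx hy m k (hk.trans_le ?_))
  gcongr

theorem expAdHom_mem (ℓ : ℕ+) (x : 𝒢 ((ℓ : ℕ) : ℤ)) : expAdHom ℓ x ∈ filteredSubgroup 𝒢 ℓ := by
  intro M y hy
  have h := incl_mem_tail (𝒢 := 𝒢) ((ℓ : ℕ) : ℤ) x
  have h1 : (1 : ℤ) ≤ ((ℓ : ℕ) : ℤ) := by exact_mod_cast ℓ.pos
  constructor
  · have := expAdEnd_sub_mem_tail_of_mem ⟨_, tail_mono h1 h⟩ h hy 1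
    simp only [expTerm, Finset.sum_range_one, Nat.factorial_zero, Nat.cast_one, inv_one, pow_zero,
      one_smul, one_mul, Module.End.one_apply] at this
    exact this
  -- The inverse of `exp (ad x)` is `exp (ad (-x))`, to which the same estimate applies.
  · have := expAdEnd_sub_mem_tail_of_mem (-⟨_, tail_mono h1 h⟩) (neg_mem h) hy 1
    simp only [expTerm, Finset.sum_range_one, Nat.factorial_zero, Nat.cast_one, inv_one, pow_zero,
      one_smul, one_mul, Module.End.one_apply] at this
    exact this

theorem expAdHom_sub_mem (ℓ : ℕ+) (x : 𝒢 ((ℓ : ℕ) : ℤ)) {N : ℤ} {y : completion 𝒢}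
    (hy : y ∈ tail 𝒢 N) :
    expAdHom ℓ x y - (y + ⁅incl 𝒢 _ x, y⁆) ∈ tail 𝒢 (N + 2 * (ℓ : ℕ)) := by
  have h := incl_mem_tail (𝒢 := 𝒢) ((ℓ : ℕ) : ℤ) x
  have h1 : (1 : ℤ) ≤ ((ℓ : ℕ) : ℤ) := by exact_mod_cast ℓ.pos
  have := expAdEnd_sub_mem_tail_of_mem ⟨_, tail_mono h1 h⟩ h hy 2
  simp only [expTerm, Finset.sum_range_succ, Finset.sum_range_zero, zero_add, Nat.factorial_zero,
    Nat.factorial_one, Nat.cast_one, Nat.cast_ofNat, inv_one, pow_zero, pow_one, one_smul,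
    Module.End.one_apply, LieAlgebra.ad_apply] at this
  exact this

end Exp

/-! ### Convergence of infinite ordered products -/

section OrderedProd

variable {u : ℕ+ → completion 𝒢 ≃ₗ⁅ℂ⁆ completion 𝒢} (hu : ∀ ℓ : ℕ+, u ℓ ∈ filteredSubgroup 𝒢 ℓ)
include hu

theorem orderedProd_mem (n : ℕ+) (N : ℕ) : orderedProd u n N ∈ filteredSubgroup 𝒢 n := by
  induction N with
  | zero => exact one_mem _
  | succ N ih =>
    have h := hu ⟨n + N, Nat.add_pos_left n.pos N⟩
    rw [PNat.mk_coe] at h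
    exact mul_mem (filteredSubgroup_mono (Nat.le_add_right _ _) h) ih

/-- Successive partial products differ by the action of `u (n + N) - 1`, which raises degrees by at
least `n + N`. -/
theorem exists_proTendsto_orderedProd (n : ℕ+) (y : completion 𝒢) :
    ∃ z, ProTendsto (fun N => orderedProd u n N y) z := by
  obtain ⟨M, hM⟩ := exists_mem_tail y
  have hmem : ∀ N, orderedProd u n N y ∈ tail 𝒢 M :=
    fun N => filtered_mem (orderedProd_mem hu n N) hM
  refine exists_proTendsto hmem fun K => ⟨(K - M).toNat, fun N hN => ?_⟩
  have h := filtered_sub_mem (hu ⟨n + N, Nat.add_pos_left n.pos N⟩) (hmem N)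
  change u _ (orderedProd u n N y) - orderedProd u n N y ∈ _
  refine tail_mono ?_ h
  rw [PNat.mk_coe]
  push_cast
  omega

theorem exists_proTendsto_orderedProd_inv (n : ℕ+) (y : completion 𝒢) :
    ∃ z, ProTendsto (fun N => (orderedProd u n N)⁻¹ y) z := by
  obtain ⟨M, hM⟩ := exists_mem_tail y
  have hmem := fun N => inv_mem (orderedProd_mem hu n N)
  refine exists_proTendsto (fun N => filtered_mem (hmem N) hM) fun K =>
    ⟨(K - M).toNat, fun N hN => ?_⟩
  -- In the inverse product the new factor acts first; the remaining factors preserve every tail, so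
  -- they do not spoil the gain in degree.
  have e : (orderedProd u n (N + 1))⁻¹ y - (orderedProd u n N)⁻¹ y =
      (orderedProd u n N)⁻¹ ((u ⟨n + N, Nat.add_pos_left n.pos N⟩)⁻¹ y - y) := by
    rw [map_sub, orderedProd, mul_inv_rev]
    rfl
  rw [e]
  refine tail_mono ?_ (filtered_mem (hmem N) (filtered_sub_mem (inv_mem (hu _)) hM))
  rw [PNat.mk_coe]
  push_cast
  omega

/-- The infinite ordered products `⋯ u (n + 1) u n` converge. -/
theorem exists_limit_orderedProd (n : ℕ+) :
    ∃ φ ∈ filteredSubgroup 𝒢 n, ∀ y, ProTendsto (fun N => orderedProd u n N y) (φ y) := by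
  choose F hF using exists_proTendsto_orderedProd hu n
  choose G hG using exists_proTendsto_orderedProd_inv hu n
  have hmem := orderedProd_mem hu n
  have hinv := fun N => inv_mem (hmem N)
  refine ⟨{ toFun := F, invFun := G, map_add' := ?_, map_smul' := ?_, map_lie' := ?_,
            left_inv := ?_, right_inv := ?_ }, ?_, hF⟩
  · intro x y
    exact (hF _).unique (by simpa only [map_add] using (hF x).add (hF y))
  · intro c x
    change F (c • x) = c • F x
    exact (hF _).unique (by simpa only [map_smul] using (hF x).const_smul c)
  · intro x y
    obtain ⟨N, hN⟩ := exists_mem_tail x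
    obtain ⟨M, hM⟩ := exists_mem_tail y
    have hx : ∀ i, orderedProd u n i x ∈ tail 𝒢 (min N M) :=
      fun i => filtered_mem (hmem i) (tail_mono (min_le_left _ _) hN)
    have hy : F y ∈ tail 𝒢 (min N M) :=
      (hF y).mem_tail fun i => filtered_mem (hmem i) (tail_mono (min_le_right _ _) hM)
    exact (hF _).unique (by simpa only [LieEquiv.map_lie] using (hF x).lie (hF y) hx hy)
  · intro y
    -- Writing `P` for the partial product, `P⁻¹ (F y) - y = P⁻¹ (F y - P y)`. Since `P⁻¹` preserves
    -- tails uniformly in the number of factors, this tends to zero.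
    refine (hG _).unique fun K => ?_
    obtain ⟨N₀, h⟩ := hF y K
    refine ⟨N₀, fun N hN => ?_⟩
    have := filtered_mem (hinv N) (h N hN)
    rw [map_sub, ← neg_mem_iff, neg_sub] at this
    have e : (orderedProd u n N)⁻¹ (orderedProd u n N y) = y := LieEquiv.symm_apply_apply _ _
    rwa [e] at this
  · intro y
    refine (hF _).unique fun K => ?_
    obtain ⟨N₀, h⟩ := hG y K
    refine ⟨N₀, fun N hN => ?_⟩
    have := filtered_mem (hmem N) (h N hN)
    rw [map_sub, ← neg_mem_iff, neg_sub] at this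
    have e : orderedProd u n N ((orderedProd u n N)⁻¹ y) = y := LieEquiv.apply_symm_apply _ _
    rwa [e] at this
  · intro M y hy
    have aux : ∀ {f : ℕ → completion 𝒢} {z}, ProTendsto f z →
        ProTendsto (fun N => f N - y) (z - y) := fun h K => by simpa using h K
    exact ⟨(aux (hF y)).mem_tail fun N => filtered_sub_mem (hmem N) hy,
      (aux (hG y)).mem_tail fun N => filtered_sub_mem (hinv N) hy⟩

end OrderedProd

/-! ### Unipotent automorphisms and the degree element -/

section DegreeElement

/-- An element of degree zero which acts on `𝒢 k` as multiplication by `k`. -/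
def IsDegreeElement (h : 𝒢 0) : Prop := ∀ (k : ℤ) (x : 𝒢 k), ⁅(h : L), (x : L)⁆ = (k : ℂ) • (x : L)

variable {h : 𝒢 0} (hh : IsDegreeElement h)
include hh

theorem degree_lie (y : completion 𝒢) (k : ℤ) : ⁅incl 𝒢 0 h, y⁆.1 k = (k : ℂ) • y.1 k := by
  refine Subtype.ext ?_
  rw [lie_coe_eq_sum _ _ k {0}, Finset.sum_singleton]
  · change ⁅((Pi.single 0 h : ∀ k, 𝒢 k) 0 : L), _⁆ = (k : ℂ) • (y.1 k : L)
    rw [Pi.single_eq_same, hh, sub_zero]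
  · intro i hi
    change ⁅((Pi.single 0 h : ∀ k, 𝒢 k) i : L), _⁆ = 0
    rw [Pi.single_eq_of_ne (by simpa using hi)]
    simp

/-- For `k < j` the operator `ad h - k` is invertible on `tail 𝒢 j`, so `y = (ad h - k) z`. As `φ`
commutes with this operator, `φ y` is also in its image, where coordinate `k` vanishes. -/
theorem map_mem_tail_of_fixes_degree {φ : completion 𝒢 ≃ₗ⁅ℂ⁆ completion 𝒢}
    (hφ : φ (incl 𝒢 0 h) = incl 𝒢 0 h) {j : ℤ} {y : completion 𝒢} (hy : y ∈ tail 𝒢 j) :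
    φ y ∈ tail 𝒢 j := by
  intro k hk
  -- At `i = k` the inverse is `0⁻¹ = 0`, which is harmless since `y` has no component there.
  let z : completion 𝒢 := ⟨fun i => ((i - k : ℂ)⁻¹) • y.1 i, j, fun i hi => by simp [hy i hi]⟩
  have hz : y = ⁅incl 𝒢 0 h, z⁆ - (k : ℂ) • z := by
    refine Subtype.ext (funext fun i => ?_)
    rw [sub_apply, degree_lie hh]
    change _ = (i : ℂ) • (i - k : ℂ)⁻¹ • y.1 i - (k : ℂ) • (i - k : ℂ)⁻¹ • y.1 i
    rw [← sub_smul, smul_smul]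
    by_cases hi : i < j
    · simp [hy i hi]
    · rw [mul_inv_cancel₀, one_smul]
      rw [sub_ne_zero]
      exact_mod_cast (by omega : i ≠ k)
  rw [hz, map_sub, LieEquiv.map_lie, hφ, map_smul, sub_apply, degree_lie hh]
  exact sub_self _

/-- A unipotent automorphism fixing the degree element is trivial. -/
theorem eq_one_of_fixes_degree {φ : completion 𝒢 ≃ₗ⁅ℂ⁆ completion 𝒢} {n : ℕ+}
    (hn : φ ∈ unipotent 𝒢 n) (hφ : φ (incl 𝒢 0 h) = incl 𝒢 0 h) : φ = 1 := by
  have hom : ∀ k (y : 𝒢 k), φ (incl 𝒢 k y) = incl 𝒢 k y := by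
    intro k y
    have hy : ⁅incl 𝒢 0 h, incl 𝒢 k y⁆ = (k : ℂ) • incl 𝒢 k y := by
      refine Subtype.ext (funext fun i => ?_)
      rw [degree_lie hh]
      change (i : ℂ) • (Pi.single k y : ∀ k, 𝒢 k) i = (k : ℂ) • (Pi.single k y : ∀ k, 𝒢 k) i
      by_cases hi : i = k
      · rw [hi]
      · rw [Pi.single_eq_of_ne (M := fun k => 𝒢 k) hi, smul_zero, smul_zero]
    refine Subtype.ext (funext fun i => ?_)
    by_cases hi : i = k
    · exact sub_mem_tail_iff.mp (hn k y) i (by have := n.pos; omega)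
    -- The image `φ (incl 𝒢 k y)` is still an eigenvector of `ad h` for `k`, so its coordinates in
    -- other degrees vanish.
    · have h1 : (i : ℂ) • (φ (incl 𝒢 k y)).1 i = (k : ℂ) • (φ (incl 𝒢 k y)).1 i := by
        rw [← degree_lie hh]
        have := congrArg φ hy
        rw [LieEquiv.map_lie, hφ, map_smul] at this
        rw [this]
        rfl
      rw [← sub_eq_zero, ← sub_smul, smul_eq_zero, sub_eq_zero] at h1
      rw [h1.resolve_left (by exact_mod_cast hi)]
      exact (Pi.single_eq_of_ne (M := fun k => 𝒢 k) hi y).symm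
  refine LieEquiv.ext fun y => ?_
  obtain ⟨N, hN⟩ := exists_mem_tail y
  refine eq_of_sub_mem_tail N fun M _ => ?_
  -- The finite truncation `s` of `y` is fixed by `φ`, and the remainder lies in a tail preserved by
  -- `φ`; hence `φ y - y` lies in arbitrarily high tails.
  set s := ∑ i ∈ Finset.Ico N (N + M), incl 𝒢 i (y.1 i) with hs
  have hsy : y - s ∈ tail 𝒢 (N + M) := by
    refine sub_mem_tail_iff.mpr fun k hk => ?_
    rw [hs, AddSubmonoidClass.coe_finsetSum, Finset.sum_apply]
    change _ = ∑ i ∈ Finset.Ico N (N + M), (Pi.single i (y.1 i) : ∀ k, 𝒢 k) k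
    by_cases hk' : N ≤ k
    · rw [Finset.sum_eq_single k]
      · rw [Pi.single_eq_same]
      · intro i _ hi
        exact Pi.single_eq_of_ne hi.symm _
      · intro h
        exact absurd (Finset.mem_Ico.mpr ⟨hk', hk⟩) h
    · rw [hN k (by omega), Finset.sum_eq_zero]
      intro i hi
      rw [Finset.mem_Ico] at hi
      exact Pi.single_eq_of_ne (by omega) _
  have hφs : φ s = s := by
    rw [hs, map_sum]
    exact Finset.sum_congr rfl fun i _ => hom i _
  have := sub_mem (map_mem_tail_of_fixes_degree hh hφ hsy) hsy
  rw [map_sub, hφs, sub_sub_sub_cancel_right] at this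
  exact this

/-- Modulo degrees above `ℓ`, `exp (ad x) v` is `v + ⁅x, h⁆ = v - ℓ x`, because `v` differs from `h`
only in positive degrees. Dividing the degree `ℓ` part of `v - w` by `ℓ` therefore gives the `x`
that cancels it. -/
theorem expAdHom_correct_degree (ℓ : ℕ+) {v w : completion 𝒢}
    (hv : v - incl 𝒢 0 h ∈ tail 𝒢 1) (hvw : v - w ∈ tail 𝒢 (ℓ : ℕ)) :
    expAdHom ℓ (((ℓ : ℕ) : ℂ)⁻¹ • (v - w).1 (ℓ : ℕ)) v - w ∈ tail 𝒢 ((ℓ : ℕ) + 1) := by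
  set x := ((ℓ : ℕ) : ℂ)⁻¹ • (v - w).1 (ℓ : ℕ) with hx
  have hℓ := ℓ.pos
  have h0 : v ∈ tail 𝒢 0 := by
    simpa using add_mem (tail_mono (by omega) hv) (incl_mem_tail 0 h)
  -- The second-order error starts in degree `2ℓ`, which is at least `ℓ + 1`.
  have h1 := tail_mono (i := ((ℓ : ℕ) : ℤ) + 1) (by omega) (expAdHom_sub_mem ℓ x h0)
  have h2 := lie_mem_tail (incl_mem_tail _ x) hv
  have h3 : v - w + ⁅incl 𝒢 _ x, incl 𝒢 0 h⁆ ∈ tail 𝒢 ((ℓ : ℕ) + 1) := by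
    intro k hk
    change (v - w).1 k + ⁅incl 𝒢 _ x, incl 𝒢 0 h⁆.1 k = 0
    rw [← lie_skew]
    change (v - w).1 k + -(⁅incl 𝒢 0 h, incl 𝒢 _ x⁆.1 k) = 0
    rw [degree_lie hh]
    change (v - w).1 k + -((k : ℂ) • (Pi.single _ x : ∀ k, 𝒢 k) k) = 0
    by_cases hk' : k < (ℓ : ℕ)
    · rw [hvw k hk', Pi.single_eq_of_ne hk'.ne, smul_zero, neg_zero, add_zero]
    · obtain rfl : k = (ℓ : ℕ) := by omega
      rw [Pi.single_eq_same, hx, smul_smul, Int.cast_natCast, mul_inv_cancel₀, one_smul,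
        add_neg_cancel]
      exact_mod_cast hℓ.ne'
  have h4 := add_mem (add_mem h1 h2) h3
  convert h4 using 1
  rw [lie_sub]
  abel

theorem exists_orderedProd_degree {φ : completion 𝒢 ≃ₗ⁅ℂ⁆ completion 𝒢} {n : ℕ+}
    (hn : φ ∈ unipotent 𝒢 n) : ∃ x : ∀ ℓ : ℕ+, 𝒢 ((ℓ : ℕ) : ℤ), ∀ N : ℕ,
      orderedProd (fun ℓ => expAdHom ℓ (x ℓ)) n N (incl 𝒢 0 h) - φ (incl 𝒢 0 h) ∈
        tail 𝒢 ((n : ℕ) + N) := by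
  set w := φ (incl 𝒢 0 h)
  -- The vectors `v N` are built by recursion before the `x ℓ`, avoiding circularity: each
  -- correction depends only on the current vector. The element `x ℓ` is then read off at `N = ℓ -
  -- n`; for `ℓ < n` the truncated subtraction gives an irrelevant value, since the product starts
  -- at `n`.
  let v : ℕ → completion 𝒢 := fun N => Nat.rec (incl 𝒢 0 h) (fun N v =>
    expAdHom ⟨n + N, Nat.add_pos_left n.pos N⟩
      (((n + N : ℕ) : ℂ)⁻¹ • (v - w).1 ((n + N : ℕ) : ℤ)) v) N
  let x : ∀ ℓ : ℕ+, 𝒢 ((ℓ : ℕ) : ℤ) := fun ℓ =>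
    ((ℓ : ℕ) : ℂ)⁻¹ • (v ((ℓ : ℕ) - n) - w).1 ((ℓ : ℕ) : ℤ)
  have hxv : ∀ N, orderedProd (fun ℓ => expAdHom ℓ (x ℓ)) n N (incl 𝒢 0 h) = v N := by
    intro N
    induction N with
    | zero => rfl
    | succ N ih =>
      change expAdHom ⟨n + N, Nat.add_pos_left n.pos N⟩ (x _)
        (orderedProd (fun ℓ => expAdHom ℓ (x ℓ)) n N (incl 𝒢 0 h)) = _
      rw [ih]
      simp only [x, PNat.mk_coe, Nat.add_sub_cancel_left]
      rfl
  refine ⟨x, fun N => ?_⟩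
  induction N with
  | zero =>
    have := neg_mem (hn 0 h)
    rw [neg_sub] at this
    exact tail_mono (j := 0 + ((n : ℕ) : ℤ)) (by simp) this
  | succ N ih =>
    rw [hxv] at ih ⊢
    have hv : v N - incl 𝒢 0 h ∈ tail 𝒢 1 := by
      rw [← hxv]
      refine tail_mono ?_ (filtered_sub_mem
        (orderedProd_mem (fun ℓ : ℕ+ => expAdHom_mem ℓ (x ℓ)) n N) (incl_mem_tail 0 h))
      have := n.pos
      omega
    have := expAdHom_correct_degree hh ⟨n + N, Nat.add_pos_left n.pos N⟩ hv
      (tail_mono (by simp) ih)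
    refine tail_mono ?_ this
    rw [PNat.mk_coe]
    push_cast
    omega

/-- Every unipotent automorphism is an infinite ordered product of exponentials. -/
theorem exists_proTendsto_of_mem_unipotent {φ : completion 𝒢 ≃ₗ⁅ℂ⁆ completion 𝒢} {n : ℕ+}
    (hn : φ ∈ unipotent 𝒢 n) : φ ∈ filteredSubgroup 𝒢 n ∧
      ∃ x : ∀ ℓ : ℕ+, 𝒢 ((ℓ : ℕ) : ℤ), ∀ y,
        ProTendsto (fun N => orderedProd (fun ℓ => expAdHom ℓ (x ℓ)) n N y) (φ y) := by
  obtain ⟨x, hx⟩ := exists_orderedProd_degree hh hn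
  obtain ⟨ψ, hψ, hlim⟩ := exists_limit_orderedProd (fun ℓ : ℕ+ => expAdHom_mem ℓ (x ℓ)) n
  have hdeg : ψ (incl 𝒢 0 h) = φ (incl 𝒢 0 h) :=
    (hlim _).unique fun K => ⟨K.toNat, fun N hN => tail_mono (by omega) (hx N)⟩
  have hfix : (ψ⁻¹ * φ) (incl 𝒢 0 h) = incl 𝒢 0 h := by
    change ψ.symm (φ _) = _
    rw [← hdeg, LieEquiv.symm_apply_apply]
  -- Only homogeneous elements are controlled by `φ`, so the splitting is `ψ⁻¹ (φ y - y) + (ψ⁻¹ y -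
  -- y)`, where just `ψ⁻¹` has to act on a general element of a tail.
  have hmem : ψ⁻¹ * φ ∈ unipotent 𝒢 n := by
    intro k y
    have h1 := filtered_mem (inv_mem hψ) (hn k y)
    have h2 := filtered_sub_mem (inv_mem hψ) (incl_mem_tail k y)
    rw [map_sub] at h1
    have := add_mem h1 h2
    rwa [sub_add_sub_cancel] at this
  obtain rfl : ψ = φ := inv_mul_eq_one.mp (eq_one_of_fixes_degree hh hmem hfix)
  exact ⟨hψ, x, hlim⟩

/-- This is what makes the unipotent automorphisms a group: their definition alone says nothing
about inverses or about infinite sums. -/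
theorem unipotent_eq_filteredSubgroup (n : ℕ+) : (unipotent 𝒢 n) = filteredSubgroup 𝒢 n :=
  Set.Subset.antisymm (fun _ hφ => (exists_proTendsto_of_mem_unipotent hh hφ).1)
    (filteredSubgroup_le_unipotent n)

end DegreeElement

end GradedLie

/-! ### Application to the Monster Lie algebra -/

namespace Monster

theorem degree_mem : h₁ + h₂ ∈ component 0 := by
  rw [component_eq]
  exact add_mem (rootSpace_le (β := (0, 0)) (by norm_num) h₁_mem)
    (rootSpace_le (β := (0, 0)) (by norm_num) h₂_mem)

/-- On the weight space for `(a, b)` the element `h₁ + h₂` acts by `a + b`. In degree zero this uses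
that `gl₂` is the full sum of weight spaces with `a + b = 0`. -/
theorem isDegreeElement : GradedLie.IsDegreeElement (𝒢 := component) ⟨h₁ + h₂, degree_mem⟩ := by
  intro k x
  exact Module.End.mem_eigenspace_iff.mp
    (weightSum_le_eigenspace k ((component_eq k).le x.2))

theorem exists_tendsto_partialProd (n : ℕ+) (x : ∀ ℓ : ℕ+, component ((ℓ : ℕ) : ℤ)) :
    ∃ φ ∈ Uhat n, Filter.Tendsto (partialProd x n) Filter.atTop (nhds φ) := by
  obtain ⟨φ, hφ, hlim⟩ := GradedLie.exists_limit_orderedProd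
    (fun ℓ : ℕ+ => GradedLie.expAdHom_mem ℓ (x ℓ)) n
  exact ⟨φ, GradedLie.filteredSubgroup_le_unipotent n hφ, GradedLie.tendsto_aut hlim⟩

theorem Uhat_eq_limits (n : ℕ+) : Uhat n = {φ | ∃ x : ∀ ℓ : ℕ+, component ((ℓ : ℕ) : ℤ),
    Filter.Tendsto (partialProd x n) Filter.atTop (nhds φ)} := by
  refine Set.Subset.antisymm (fun φ hφ => ?_) ?_
  · obtain ⟨-, x, hx⟩ := GradedLie.exists_proTendsto_of_mem_unipotent isDegreeElement hφ
    exact ⟨x, GradedLie.tendsto_aut hx⟩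
  · rintro φ ⟨x, hx⟩
    obtain ⟨ψ, hψ, hlim⟩ := exists_tendsto_partialProd n x
    rwa [tendsto_nhds_unique hx hlim]

theorem Uhat_eq_closure (n : ℕ+) : Uhat n =
    closure (Subgroup.closure {φ : AutHat | ∃ k : ℕ+, n ≤ k ∧
      ∃ x : component ((k : ℕ) : ℤ), φ = expAd k x} : Set AutHat) := by
  refine Set.Subset.antisymm (fun φ hφ => ?_)
    (closure_minimal ?_ (GradedLie.isClosed_unipotent n))
  · rw [Uhat_eq_limits] at hφ
    obtain ⟨x, hx⟩ := hφ
    refine mem_closure_of_tendsto hx (Filter.Eventually.of_forall fun N => ?_)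
    induction N with
    | zero => exact one_mem _
    | succ N ih =>
      refine mul_mem (Subgroup.subset_closure ⟨_, ?_, _, rfl⟩) ih
      exact Nat.le_add_right _ _
  -- Once `Uhat n` is known to be a closed subgroup, it is enough that it contains the generators;
  -- those of degree `k ≥ n` lie in the smaller group of index `k`.
  · rw [Uhat, GradedLie.unipotent_eq_filteredSubgroup isDegreeElement, SetLike.coe_subset_coe,
      Subgroup.closure_le]
    rintro _ ⟨k, hk, x, rfl⟩
    exact GradedLie.filteredSubgroup_mono hk (GradedLie.expAdHom_mem k x)

end Monster

theorem mainTheorem2 (n : ℕ+) :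
    (∀ x : ∀ ℓ : ℕ+, Monster.component ((ℓ : ℕ) : ℤ), ∃! φ : Monster.AutHat,
      Filter.Tendsto (Monster.partialProd x n) Filter.atTop (nhds φ)) ∧
    (∃ H : Subgroup Monster.AutHat, (H : Set Monster.AutHat) = Monster.Uhat n) ∧
    Monster.Uhat n =
      {φ | ∃ x : ∀ ℓ : ℕ+, Monster.component ((ℓ : ℕ) : ℤ),
        Filter.Tendsto (Monster.partialProd x n) Filter.atTop (nhds φ)} ∧
    Monster.Uhat n =
      closure (Subgroup.closure {φ : Monster.AutHat | ∃ k : ℕ+, n ≤ k ∧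
        ∃ x : Monster.component ((k : ℕ) : ℤ), φ = Monster.expAd k x} : Set Monster.AutHat) := by
  refine ⟨fun x => ?_, ⟨GradedLie.filteredSubgroup Monster.component n,
    (GradedLie.unipotent_eq_filteredSubgroup Monster.isDegreeElement n).symm⟩,
    Monster.Uhat_eq_limits n, Monster.Uhat_eq_closure n⟩
  obtain ⟨φ, -, hφ⟩ := Monster.exists_tendsto_partialProd n x
  exact ⟨φ, hφ, fun ψ hψ => tendsto_nhds_unique hψ hφ⟩
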